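/- Let $\mathcal T\subset\mathbb R^3$ be a nondegenerate closed tetrahedron with nodes $\boldsymbol p_1,\dots,\boldsymbol p_4$ and volume $V$. Let $T^i$ be its face opposite to $\boldsymbol p_i$, with outward unit normal $\hat{\boldsymbol n}_i$. Let $\boldsymbol\varphi=(\varphi_1,\dots,\varphi_4)^T$ be the linear basis functions, i.e. the affine functions with $\varphi_i(\boldsymbol p_j)=\delta_{ij}$, written as $\boldsymbol\varphi(\boldsymbol r)=\frac1{6V}(\tilde{\boldsymbol a}+\boldsymbol\Lambda^T\boldsymbol r)$ with $\tilde{\boldsymbol a}\in\mathbb R^4$, $\boldsymbol\Lambda\in\mathbb R^{3\times4}$. Let $\overline{\boldsymbol\sigma}^c\in\mathbb R^{3\times 3}$ be the (constant) tensor on $\mathcal T$, $\sigma^\infty>0$, and let $f(\boldsymbol r)=\boldsymbol q\cdot\boldsymbol R\,R^{-3}$ with $\boldsymbol R=\boldsymbol r-\boldsymbol r_0$, $R=|\boldsymbol R|$, be the potential (up to the factor $\frac1{4\pi\sigma^\infty}$) of a dipole at $\boldsymbol r_0$ with moment $\boldsymbol q$. The volume element vector $\boldsymbol b^v\in\mathbb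 R^4$ has the entries $$b^v_i=\frac1{4\pi\sigma^\infty}\int_{\mathcal T}\big\langle\overline{\boldsymbol\sigma}^c\nabla f(\boldsymbol r),\nabla\varphi_i(\boldsymbol r)\big\rangle\,d\boldsymbol r .$$ For a triangle with nodes $\boldsymbol P_1,\boldsymbol P_2,\boldsymbol P_3$ (indices modulo 3) put $\hat{\boldsymbol s}_l=\frac{\boldsymbol P_{l-1}-\boldsymbol P_{l+1}}{|\boldsymbol P_{l-1}-\boldsymbol P_{l+1}|}$, let $\hat{\boldsymbol w}$ be the unit vector in the direction of $\hat{\boldsymbol s}_1\times\hat{\boldsymbol s}_2$, and let $\hat{\boldsymbol m}_l=\hat{\boldsymbol s}_l\times\hat{\boldsymbol w}$. Write $\boldsymbol r_0=\boldsymbol\rho-w_0\hat{\boldsymbol w}$ with $\boldsymbol\rho$ in the plane of the triangle, and let $t_l^0$, $s_l^\pm$ be the reals with $\boldsymbol P_{l+1}=\boldsymbol\rho+t^0_l\hat{\boldsymbol m}_l+s_l^-\hat{\boldsymbol s}_l$ and $\boldsymbol P_{l-1}=\boldsymbol\rho+t^0_l\hat{\boldsymbol m}_l+s_l^+\hat{\boldsymbol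 s}_l$. Let $R_l^0=\sqrt{(t_l^0)^2+w_0^2}$, $R_l^\pm=\sqrt{(s_l^\pm)^2+(t_l^0)^2+w_0^2}$, $$f_{2l}=\ln\frac{R_l^++s_l^+}{R_l^-+s_l^-},\qquad \beta_l=\tan^{-1}\frac{t_l^0s_l^+}{(R_l^0)^2+|w_0|R_l^+}-\tan^{-1}\frac{t_l^0s_l^-}{(R_l^0)^2+|w_0|R_l^-},\qquad \boldsymbol\beta=\beta_1+\beta_2+\beta_3,$$ where $\tan^{-1}$ is the principal branch and a quotient $\frac00$ inside it is read as $0$. A superscript $i$ on these quantities means that they are formed for the face $T^i$, with its nodes numbered in any order. **(a)** If $\boldsymbol r_0\notin\mathcal T$, then the integrals defining $\boldsymbol b^v$ converge absolutely and $$\boldsymbol b^v=\frac{\boldsymbol\Lambda^T\overline{\boldsymbol\sigma}^c}{24V\pi\sigma^\infty}\sum_{i=1}^4\hat{\boldsymbol n}_i\int_{T^i}f\,dS .$$ **(b)** If $\boldsymbol r_0\notin T^i$, then $f$ and $\nabla\frac1R$ are integrable over $T^i$ with respect to surface area and $\int_{T^i}f\,dS=-\boldsymbol q\cdot\int_{T^i}\nabla\frac1R\,dS$.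 If moreover the three quotients in $f^i_{2l}$ are defined, i.e. $R_l^-+s_l^-\neq0$ for $l=1,2,3$ (equivalently, $\boldsymbol r_0$ does not lie on the extension of a side of $T^i$ beyond its end point $\boldsymbol P_{l-1}$), then $$\int_{T^i}f\,dS=-\boldsymbol q\cdot\Big(-\hat{\boldsymbol w}^i\,\mathrm{sgn}(w_0^i)\,\boldsymbol\beta^i+\sum_{l=1}^3\hat{\boldsymbol m}_l^i f_{2l}^i\Big).$$ -/

import Mathlib

open Real MeasureTheory
open scoped Matrix Gradient

noncomputable section

namespace EEG

/-- Euclidean three-space. -/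
abbrev E3 : Type := EuclideanSpace ℝ (Fin 3)

/-- The cross product of `ℝ³`. -/
def cross (a b : E3) : E3 := WithLp.toLp 2 (crossProduct a.ofLp b.ofLp)

/-- The unit vector `v / |v|`. -/
def unit (v : E3) : E3 := ‖v‖⁻¹ • v

/-! ### The dipolar source -/

/-- `1 / R`, where `R = |r - r₀|`. -/
def invDist (r0 r : E3) : ℝ := 1 / ‖r - r0‖

/-- `f(r) = q ⬝ R / R³`, where `R = r - r₀`: the potential of a dipole with moment `q` located
at `r₀`, up to the factor `1 / (4πσ^∞)`. -/
def dipole (q r0 r : E3) : ℝ := inner ℝ q (r - r0) / ‖r - r0‖ ^ 3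

/-! ### The tetrahedral element

A nondegenerate tetrahedron is given by four affinely independent nodes in `ℝ³`, that is, by an
affine basis of `ℝ³` indexed by `Fin 4`. Its linear basis functions, the affine functions with
`φ_i(p_j) = δ_{ij}`, are the barycentric coordinates `p.coord i`. -/

/-- The (closed, solid) tetrahedron. -/
def tetra (p : AffineBasis (Fin 4) ℝ E3) : Set E3 := convexHull ℝ (Set.range p)

/-- The volume `V` of the tetrahedron. -/
def vol (p : AffineBasis (Fin 4) ℝ E3) : ℝ := volume.real (tetra p)

/-- The triangular face opposite to the node `p_i`. -/
def face (p : AffineBasis (Fin 4) ℝ E3) (i : Fin 4) : Set E3 := convexHull ℝ (p '' {j | j ≠ i})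

/-- A (non-normalised) normal vector of the face opposite to the node `p_i`. -/
def faceNormal (p : AffineBasis (Fin 4) ℝ E3) (i : Fin 4) : E3 :=
  cross (p (i.succAbove 1) - p (i.succAbove 0)) (p (i.succAbove 2) - p (i.succAbove 0))

/-- The unit normal of the face opposite to `p_i` that points out of the tetrahedron, i.e. away
from `p_i`. -/
def outwardNormal (p : AffineBasis (Fin 4) ℝ E3) (i : Fin 4) : E3 :=
  Real.sign (inner ℝ (faceNormal p i) (p (i.succAbove 0) - p i)) • unit (faceNormal p i)

/-- The constant coefficients `a_i` of the volume coordinates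
`ξ_i = (a_i + b_i x₁ + c_i x₂ + d_i x₃) / (6V)`. -/
def coefA (p : AffineBasis (Fin 4) ℝ E3) (i : Fin 4) : ℝ := 6 * vol p * p.coord i 0

/-- The `3 × 4` matrix `Λ`, whose `i`-th column consists of the linear coefficients
`b_i, c_i, d_i` of the volume coordinates `ξ_i = (a_i + b_i x₁ + c_i x₂ + d_i x₃) / (6V)`. -/
def Lam (p : AffineBasis (Fin 4) ℝ E3) : Matrix (Fin 3) (Fin 4) ℝ :=
  Matrix.of fun k i => 6 * vol p * (p.coord i).linear (EuclideanSpace.single k 1)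

/-- The integrand `⟨σ^c ∇f, ∇φ_i⟩` of the volume element vector. -/
def bvIntegrand (p : AffineBasis (Fin 4) ℝ E3) (σc : Matrix (Fin 3) (Fin 3) ℝ) (q r0 : E3)
    (i : Fin 4) (r : E3) : ℝ :=
  inner ℝ (WithLp.toLp 2 (σc *ᵥ (∇ (dipole q r0) r).ofLp) : E3) (∇ (fun x => p.coord i x) r)

/-- The volume element vector `b^v`, with entries `(4πσ^∞)⁻¹ ∫_𝒯 ⟨σ^c ∇f, ∇φ_i⟩ dr`. -/
def bv (p : AffineBasis (Fin 4) ℝ E3) (σc : Matrix (Fin 3) (Fin 3) ℝ) (σinf : ℝ) (q r0 : E3) :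
    Fin 4 → ℝ :=
  fun i => 1 / (4 * π * σinf) * ∫ r in tetra p, bvIntegrand p σc q r0 i r

theorem vol_pos (p : AffineBasis (Fin 4) ℝ E3) : 0 < vol p := by
  have hc : IsCompact (tetra p) := (Set.finite_range p).isCompact_convexHull ℝ
  have hi : (interior (tetra p)).Nonempty :=
    interior_convexHull_nonempty_iff_affineSpan_eq_top.2 p.tot
  exact ENNReal.toReal_pos (Measure.measure_pos_of_nonempty_interior _ hi).ne'
    hc.measure_lt_top.ne

/-- `ξ = (6V)⁻¹ (ã + Λᵀ r)`: the numbers `coefA` and the matrix `Lam` are the coefficients of the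
volume coordinates. -/
theorem coord_eq (p : AffineBasis (Fin 4) ℝ E3) (i : Fin 4) (r : E3) :
    p.coord i r = 1 / (6 * vol p) * (coefA p i + ((Lam p)ᵀ *ᵥ r.ofLp) i) := by
  have hV := (vol_pos p).ne'
  have h1 : p.coord i r = (p.coord i).linear r + p.coord i 0 := by
    have := (p.coord i).map_vadd 0 r
    simpa using this
  have h2 : (p.coord i).linear r
      = ∑ k, r k * (p.coord i).linear (EuclideanSpace.single k 1) := by
    have hr : r = ∑ k, r k • (EuclideanSpace.single k 1 : E3) := by
      ext j
      fin_cases j <;> simp [Fin.sum_univ_three]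
    conv_lhs => rw [hr]
    simp
  rw [h1, h2]
  simp only [coefA, Lam, Matrix.mulVec, dotProduct, Matrix.transpose_apply, Matrix.of_apply,
    Fin.sum_univ_three]
  field_simp
  ring

/-! ### The local frame of a triangle

The nodes of a triangle are `P 0, P 1, P 2`, with indices taken modulo `3`; side `l` is the side
opposite to `P l`. -/

/-- `ŝ_l`: the unit vector along side `l`, running from `P (l+1)` to `P (l-1)`. -/
def sHat (P : Fin 3 → E3) (l : Fin 3) : E3 := unit (P (l - 1) - P (l + 1))

/-- `ŵ`: the unit normal of the triangle in the direction of `ŝ_1 × ŝ_2` (sides counted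
from `1`). -/
def wHat (P : Fin 3 → E3) : E3 := unit (cross (sHat P 0) (sHat P 1))

/-- `m̂_l = ŝ_l × ŵ`. -/
def mHat (P : Fin 3 → E3) (l : Fin 3) : E3 := cross (sHat P l) (wHat P)

/-- `w₀`: the signed distance with `r₀ = ρ - w₀ ŵ`, where `ρ` lies in the plane of the
triangle. -/
def w0 (P : Fin 3 → E3) (r0 : E3) : ℝ := inner ℝ (P 0 - r0) (wHat P)

/-- `ρ`: the orthogonal projection of `r₀` onto the plane of the triangle. -/
def rho (P : Fin 3 → E3) (r0 : E3) : E3 := r0 + w0 P r0 • wHat P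

/-- `t_l⁰`: the point of the line of side `l` that is closest to `ρ` is `ρ + t_l⁰ m̂_l`. -/
def t0 (P : Fin 3 → E3) (r0 : E3) (l : Fin 3) : ℝ := inner ℝ (P (l + 1) - rho P r0) (mHat P l)

/-- `s_l⁻`: the starting point of side `l` is `P (l+1) = ρ + t_l⁰ m̂_l + s_l⁻ ŝ_l`. -/
def sMinus (P : Fin 3 → E3) (r0 : E3) (l : Fin 3) : ℝ :=
  inner ℝ (P (l + 1) - rho P r0) (sHat P l)

/-- `s_l⁺`: the end point of side `l` is `P (l-1) = ρ + t_l⁰ m̂_l + s_l⁺ ŝ_l`. -/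
def sPlus (P : Fin 3 → E3) (r0 : E3) (l : Fin 3) : ℝ :=
  inner ℝ (P (l - 1) - rho P r0) (sHat P l)

/-- `R_l⁰`, the distance from `r₀` to the line of side `l`. -/
def Rzero (P : Fin 3 → E3) (r0 : E3) (l : Fin 3) : ℝ := √(t0 P r0 l ^ 2 + w0 P r0 ^ 2)

/-- `R_l⁻`, the distance from `r₀` to the starting point of side `l`. -/
def RMinus (P : Fin 3 → E3) (r0 : E3) (l : Fin 3) : ℝ :=
  √(sMinus P r0 l ^ 2 + t0 P r0 l ^ 2 + w0 P r0 ^ 2)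

/-- `R_l⁺`, the distance from `r₀` to the end point of side `l`. -/
def RPlus (P : Fin 3 → E3) (r0 : E3) (l : Fin 3) : ℝ :=
  √(sPlus P r0 l ^ 2 + t0 P r0 l ^ 2 + w0 P r0 ^ 2)

/-- `f_{2l} = ln ((R_l⁺ + s_l⁺) / (R_l⁻ + s_l⁻))`. -/
def f2 (P : Fin 3 → E3) (r0 : E3) (l : Fin 3) : ℝ :=
  Real.log ((RPlus P r0 l + sPlus P r0 l) / (RMinus P r0 l + sMinus P r0 l))

/-- `β_l`. -/
def betaSide (P : Fin 3 → E3) (r0 : E3) (l : Fin 3) : ℝ :=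
  Real.arctan (t0 P r0 l * sPlus P r0 l / (Rzero P r0 l ^ 2 + |w0 P r0| * RPlus P r0 l)) -
  Real.arctan (t0 P r0 l * sMinus P r0 l / (Rzero P r0 l ^ 2 + |w0 P r0| * RMinus P r0 l))

/-- `β = β_1 + β_2 + β_3`. -/
def beta (P : Fin 3 → E3) (r0 : E3) : ℝ := ∑ l, betaSide P r0 l

/-- The vector `-ŵ sgn(w₀) β + Σ_l m̂_l f_{2l}`. -/
def faceVector (P : Fin 3 → E3) (r0 : E3) : E3 :=
  -((Real.sign (w0 P r0) * beta P r0) • wHat P) + ∑ l, f2 P r0 l • mHat P l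

end EEG

end

/-! On an `n`-simplex every edge vector `v` satisfies `∫ ∂_v g = Σ_i ⟨ν_i, v⟩ ∫_{facet i} g`: in
coordinates on the standard simplex this is the fundamental theorem of calculus along lines, and
the surface measures of the simplex and of a facet scale by factors whose quotient is the height.
With `n = 3` this turns the volume integral of `∇f` into face integrals of `f`.

A face integral of `f` is that of `-q ⬝ ∇(1/R)`. The part of `∇(1/R)` tangent to the face is again
integrated by the divergence theorem, now with `n = 2`, and leaves the side integrals of `1/R`,
which are the logarithms `f_{2l}`. The normal part is `-w₀/R³`, and `|w₀|/R³` is the divergence,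
within the plane of the face, of `(r - ρ) / (R (R + |w₀|))`, whose flux through side `l` is `β_l`.
-/

noncomputable section

namespace EEG

/-! ### The gradient theorem on a simplex -/

/-- The corner simplex of `ℝⁿ`, which parametrises all `n`-dimensional simplices. -/
def cornerSimplex (n : ℕ) : Set (Fin n → ℝ) := {x | (∀ i, 0 ≤ x i) ∧ ∑ i, x i ≤ 1}

theorem isCompact_cornerSimplex (n : ℕ) : IsCompact (cornerSimplex n) := by
  have hclosed : IsClosed (cornerSimplex n) := by
    have hinter : cornerSimplex n = (⋂ i, {x | 0 ≤ x i}) ∩ {x | ∑ i, x i ≤ 1} := by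
      ext x
      simp [cornerSimplex]
    rw [hinter]
    exact (isClosed_iInter fun i => isClosed_le continuous_const (continuous_apply i)).inter
      (isClosed_le (by fun_prop) continuous_const)
  refine (isCompact_Icc (a := (0 : Fin n → ℝ)) (b := 1)).of_isClosed_subset hclosed ?_
  rintro x ⟨hnonneg, hsum⟩
  exact ⟨hnonneg, fun i =>
    (Finset.single_le_sum (fun j _ => hnonneg j) (Finset.mem_univ i)).trans hsum⟩

theorem measurableSet_cornerSimplex (n : ℕ) : MeasurableSet (cornerSimplex n) :=
  (isCompact_cornerSimplex n).measurableSet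

theorem volume_cornerSimplex_ne_zero (n : ℕ) : volume (cornerSimplex n) ≠ 0 := by
  have hn : (0 : ℝ) < (n : ℝ) + 1 := by positivity
  have hsub : Set.Icc (0 : Fin n → ℝ) (fun _ => ((n : ℝ) + 1)⁻¹) ⊆ cornerSimplex n := by
    refine fun x hx => ⟨hx.1, ?_⟩
    calc ∑ i, x i ≤ ∑ _i : Fin n, ((n : ℝ) + 1)⁻¹ := Finset.sum_le_sum fun i _ => hx.2 i
      _ ≤ 1 := by
        rw [Finset.sum_const, Finset.card_univ, Fintype.card_fin, nsmul_eq_mul,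
          ← div_eq_mul_inv, div_le_one hn]
        linarith
  have hpos : volume (Set.Icc (0 : Fin n → ℝ) (fun _ => ((n : ℝ) + 1)⁻¹)) ≠ 0 := by
    simp [Real.volume_Icc_pi, hn.not_ge]
  exact fun h => hpos (measure_mono_null hsub h)

theorem cons_mem_cornerSimplex {n : ℕ} {z : ℝ} {u : Fin n → ℝ} :
    (Fin.cons z u : Fin (n + 1) → ℝ) ∈ cornerSimplex (n + 1) ↔
      u ∈ cornerSimplex n ∧ z ∈ Set.Icc 0 (1 - ∑ i, u i) := by
  simp only [cornerSimplex, Set.mem_ofPred_eq, Fin.forall_fin_succ, Fin.cons_zero, Fin.cons_succ,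
    Fin.sum_univ_succ, Set.mem_Icc]
  constructor
  · rintro ⟨⟨h0, h1⟩, h2⟩
    exact ⟨⟨h1, by linarith⟩, h0, by linarith⟩
  · rintro ⟨⟨h1, -⟩, h0, h2⟩
    exact ⟨⟨h0, h1⟩, by linarith⟩

section

variable {F : Type*} [NormedAddCommGroup F] [NormedSpace ℝ F] {n : ℕ}

theorem integral_fin_cons {f : (Fin (n + 1) → ℝ) → F} (hf : Integrable f) :
    ∫ x, f x = ∫ u : Fin n → ℝ, ∫ z : ℝ, f (Fin.cons z u) := by
  have hmp := (volume_preserving_piFinSuccAbove (fun _ : Fin (n + 1) => ℝ) 0).symm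
  rw [← hmp.integral_comp (MeasurableEquiv.measurableEmbedding _), Measure.volume_eq_prod]
  refine (integral_prod_symm _
    ((hmp.integrable_comp_emb (MeasurableEquiv.measurableEmbedding _)).2 hf)).trans ?_
  simp only [Function.comp_apply, MeasurableEquiv.piFinSuccAbove_symm_apply,
    Fin.insertNthEquiv_zero]
  rfl

theorem setIntegral_cornerSimplex_succ {f : (Fin (n + 1) → ℝ) → F}
    (hf : IntegrableOn f (cornerSimplex (n + 1))) :
    ∫ x in cornerSimplex (n + 1), f x =
      ∫ u in cornerSimplex n, ∫ z in (0 : ℝ)..(1 - ∑ i, u i), f (Fin.cons z u) := by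
  have hslice (u : Fin n → ℝ) :
      (fun z : ℝ => (cornerSimplex (n + 1)).indicator f (Fin.cons z u)) =
        (cornerSimplex n).indicator
          (fun u => (Set.Icc 0 (1 - ∑ i, u i)).indicator fun z => f (Fin.cons z u)) u := by
    ext z
    by_cases hu : u ∈ cornerSimplex n <;> by_cases hz : z ∈ Set.Icc 0 (1 - ∑ i, u i) <;>
      simp [Set.indicator, cons_mem_cornerSimplex, hu, hz]
  rw [← integral_indicator (measurableSet_cornerSimplex _), integral_fin_cons
    ((integrable_indicator_iff (measurableSet_cornerSimplex _)).2 hf),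
    ← integral_indicator (measurableSet_cornerSimplex _)]
  refine integral_congr_ae (.of_forall fun u => ?_)
  simp only [hslice]
  by_cases hu : u ∈ cornerSimplex n
  · rw [Set.indicator_of_mem hu, Set.indicator_of_mem hu, integral_indicator measurableSet_Icc,
      integral_Icc_eq_integral_Ioc, intervalIntegral.integral_of_le (by linarith [hu.2])]
  · simp [Set.indicator_of_notMem hu]

end

/-- The affine map from the corner simplex onto the simplex with vertices `P`. -/
def simplexMap {E : Type*} [AddCommGroup E] [Module ℝ E] {n : ℕ} (P : Fin (n + 1) → E)
    (x : Fin n → ℝ) : E :=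
  P 0 + ∑ i, x i • (P i.succ - P 0)

section

variable {E : Type*} [AddCommGroup E] [Module ℝ E] {n : ℕ}

theorem simplexMap_image (P : Fin (n + 1) → E) :
    simplexMap P '' cornerSimplex n = convexHull ℝ (Set.range P) := by
  have hrange : Set.range P = Fintype.linearCombination ℝ P ''
      Set.range (fun i : Fin (n + 1) => (Pi.single i 1 : Fin (n + 1) → ℝ)) := by
    rw [← Set.range_comp]
    congr 1
    ext i
    simp
  rw [hrange, ← LinearMap.image_convexHull, convexHull_rangle_single_eq_stdSimplex]
  have hmap (x : Fin (n + 1) → ℝ) (hx : x 0 = 1 - ∑ i : Fin n, x i.succ) :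
      simplexMap P (Fin.tail x) = Fintype.linearCombination ℝ P x := by
    simp only [Fintype.linearCombination_apply, Fin.sum_univ_succ, simplexMap, smul_sub,
      Finset.sum_sub_distrib, hx, sub_smul, one_smul, ← Finset.sum_smul, Fin.tail]
    abel
  ext y
  constructor
  · rintro ⟨x, ⟨hnonneg, hsum⟩, rfl⟩
    refine ⟨Fin.cons (1 - ∑ i, x i) x, ⟨fun i => ?_, ?_⟩, ?_⟩
    · refine Fin.cases ?_ (fun j => ?_) i
      · simpa using hsum
      · simpa using hnonneg j
    · simp [Fin.sum_univ_succ]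
    · rw [← hmap _ (by simp), Fin.tail_cons]
  · rintro ⟨x, ⟨hnonneg, hsum⟩, rfl⟩
    rw [Fin.sum_univ_succ] at hsum
    exact ⟨Fin.tail x, ⟨fun i => hnonneg _, by simp only [Fin.tail]; linarith [hnonneg 0]⟩,
      hmap x (by linarith)⟩

theorem simplexMap_mem (P : Fin (n + 1) → E) {x : Fin n → ℝ} (hx : x ∈ cornerSimplex n) :
    simplexMap P x ∈ convexHull ℝ (Set.range P) :=
  simplexMap_image P ▸ Set.mem_image_of_mem _ hx

theorem simplexMap_cons (P : Fin (n + 2) → E) (z : ℝ) (u : Fin n → ℝ) :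
    simplexMap P (Fin.cons z u) =
      simplexMap (P ∘ (1 : Fin (n + 2)).succAbove) u + z • (P 1 - P 0) := by
  have hsucc (i : Fin n) : (1 : Fin (n + 2)).succAbove i.succ = i.succ.succ := by
    rw [← Fin.succ_zero_eq_one, Fin.succ_succAbove_succ, Fin.succAbove_zero]
  simp only [simplexMap, Fin.sum_univ_succ, Fin.cons_zero, Fin.cons_succ, Function.comp_apply,
    hsucc, Fin.one_succAbove_zero, Fin.succ_zero_eq_one]
  abel

theorem simplexMap_cons_top (P : Fin (n + 2) → E) (u : Fin n → ℝ) :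
    simplexMap P (Fin.cons (1 - ∑ i, u i) u) =
      simplexMap (P ∘ (0 : Fin (n + 2)).succAbove) u := by
  simp only [simplexMap, Fin.sum_univ_succ, Fin.cons_zero, Fin.cons_succ, Function.comp_apply,
    Fin.succAbove_zero, Fin.succ_zero_eq_one, smul_sub, Finset.sum_sub_distrib, sub_smul,
    one_smul, ← Finset.sum_smul]
  module

end

section

variable {E : Type*} [NormedAddCommGroup E] [NormedSpace ℝ E] {n : ℕ}

theorem continuous_simplexMap (P : Fin (n + 1) → E) : Continuous (simplexMap P) := by
  unfold simplexMap
  fun_prop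

theorem isCompact_convexHull_range (P : Fin (n + 1) → E) :
    IsCompact (convexHull ℝ (Set.range P)) :=
  (Set.finite_range P).isCompact_convexHull ℝ

variable {F : Type*} [NormedAddCommGroup F] {g : E → F}

theorem integrableOn_comp_simplexMap {P : Fin (n + 1) → E}
    (hg : ContinuousOn g (convexHull ℝ (Set.range P))) :
    IntegrableOn (fun x => g (simplexMap P x)) (cornerSimplex n) :=
  (hg.comp (continuous_simplexMap P).continuousOn
    fun _ hx => simplexMap_mem P hx).integrableOn_compact (isCompact_cornerSimplex n)

theorem integral_fderiv_edge_slice [NormedSpace ℝ F] [CompleteSpace F]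
    {P : Fin (n + 2) → E}
    (hg : ∀ r ∈ convexHull ℝ (Set.range P), ContDiffAt ℝ 1 g r) {u : Fin n → ℝ}
    (hu : u ∈ cornerSimplex n) :
    ∫ z in (0 : ℝ)..(1 - ∑ i, u i), fderiv ℝ g (simplexMap P (Fin.cons z u)) (P 1 - P 0) =
      g (simplexMap (P ∘ (0 : Fin (n + 2)).succAbove) u) -
        g (simplexMap (P ∘ (1 : Fin (n + 2)).succAbove) u) := by
  have hgz (z : ℝ) (hz : z ∈ Set.uIcc 0 (1 - ∑ i, u i)) :
      ContDiffAt ℝ 1 g (simplexMap P (Fin.cons z u)) :=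
    hg _ (simplexMap_mem P (cons_mem_cornerSimplex.2
      ⟨hu, by rwa [Set.uIcc_of_le (by linarith [hu.2])] at hz⟩))
  have hline (z : ℝ) : HasDerivAt (fun z => simplexMap P (Fin.cons z u)) (P 1 - P 0) z := by
    simp only [simplexMap_cons]
    simpa using ((hasDerivAt_id z).smul_const (P 1 - P 0)).const_add
      (simplexMap (P ∘ (1 : Fin (n + 2)).succAbove) u)
  have hcont : ContinuousOn (fun z => fderiv ℝ g (simplexMap P (Fin.cons z u)) (P 1 - P 0))
      (Set.uIcc 0 (1 - ∑ i, u i)) := fun z hz =>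
    ((((hgz z hz).continuousAt_fderiv one_ne_zero).comp_of_eq (hline z).continuousAt rfl).clm_apply
      continuousAt_const).continuousWithinAt
  rw [intervalIntegral.integral_eq_sub_of_hasDerivAt (fun z hz =>
      ((hgz z hz).differentiableAt one_ne_zero).hasFDerivAt.comp_hasDerivAt z (hline z))
    hcont.intervalIntegrable, Function.comp_apply, Function.comp_apply, simplexMap_cons_top,
    simplexMap_cons, zero_smul, add_zero]

variable [MeasurableSpace E] [BorelSpace E]

/-- The push-forward of Lebesgue measure on the corner simplex to the simplex with vertices `P`:
the surface measure of that simplex, up to a constant factor. -/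
def simplexMeasure (P : Fin (n + 1) → E) : Measure E :=
  (volume.restrict (cornerSimplex n)).map (simplexMap P)

theorem simplexMeasure_univ (P : Fin (n + 1) → E) :
    simplexMeasure P Set.univ = volume (cornerSimplex n) := by
  rw [simplexMeasure, Measure.map_apply (continuous_simplexMap P).measurable .univ,
    Set.preimage_univ, Measure.restrict_apply_univ]

instance (P : Fin (n + 1) → E) : IsFiniteMeasure (simplexMeasure P) :=
  ⟨simplexMeasure_univ P ▸ (isCompact_cornerSimplex n).measure_lt_top⟩

theorem simplexMeasure_restrict_convexHull (P : Fin (n + 1) → E) :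
    (simplexMeasure P).restrict (convexHull ℝ (Set.range P)) = simplexMeasure P := by
  refine Measure.restrict_eq_self_of_ae_mem ?_
  refine (ae_map_iff (continuous_simplexMap P).measurable.aemeasurable
    (isCompact_convexHull_range P).measurableSet).2 ?_
  filter_upwards [ae_restrict_mem (measurableSet_cornerSimplex n)] with x hx
  exact simplexMap_mem P hx

theorem integrable_simplexMeasure {P : Fin (n + 1) → E}
    (hg : ContinuousOn g (convexHull ℝ (Set.range P))) : Integrable g (simplexMeasure P) := by
  rw [← simplexMeasure_restrict_convexHull]
  exact hg.integrableOn_compact (isCompact_convexHull_range P)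

variable [NormedSpace ℝ F]

theorem integral_simplexMeasure {P : Fin (n + 1) → E}
    (hg : ContinuousOn g (convexHull ℝ (Set.range P))) :
    ∫ r, g r ∂simplexMeasure P = ∫ x in cornerSimplex n, g (simplexMap P x) :=
  integral_map (continuous_simplexMap P).measurable.aemeasurable
    (integrable_simplexMeasure hg).aestronglyMeasurable

theorem integral_fderiv_edge_simplexMeasure [CompleteSpace F] {P : Fin (n + 2) → E}
    (hg : ∀ r ∈ convexHull ℝ (Set.range P), ContDiffAt ℝ 1 g r) :
    ∫ r, fderiv ℝ g r (P 1 - P 0) ∂simplexMeasure P =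
      ∫ r, g r ∂simplexMeasure (P ∘ (0 : Fin (n + 2)).succAbove) -
        ∫ r, g r ∂simplexMeasure (P ∘ (1 : Fin (n + 2)).succAbove) := by
  have hcont (i : Fin (n + 2)) : ContinuousOn g (convexHull ℝ (Set.range (P ∘ i.succAbove))) :=
    fun r hr => (hg r (convexHull_mono (Set.range_comp_subset_range _ P) hr)).continuousAt
      |>.continuousWithinAt
  have hcont' : ContinuousOn (fun r => fderiv ℝ g r (P 1 - P 0)) (convexHull ℝ (Set.range P)) :=
    fun r hr => (((hg r hr).continuousAt_fderiv one_ne_zero).clm_apply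
      continuousAt_const).continuousWithinAt
  rw [integral_simplexMeasure hcont', integral_simplexMeasure (hcont 0),
    integral_simplexMeasure (hcont 1),
    setIntegral_cornerSimplex_succ (integrableOn_comp_simplexMap hcont'),
    ← integral_sub (integrableOn_comp_simplexMap (hcont 0))
      (integrableOn_comp_simplexMap (hcont 1))]
  exact setIntegral_congr_fun (measurableSet_cornerSimplex _) fun u hu =>
    integral_fderiv_edge_slice hg hu

end

section

variable {E : Type*} [NormedAddCommGroup E] [InnerProductSpace ℝ E]

/-- The linear part of `simplexMap P`, on Euclidean space. -/
def edgeMap {n : ℕ} (P : Fin (n + 1) → E) : EuclideanSpace ℝ (Fin n) →ₗ[ℝ] E :=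
  Fintype.linearCombination ℝ (fun i : Fin n => P i.succ - P 0) ∘ₗ
    (WithLp.linearEquiv 2 ℝ (Fin n → ℝ)).toLinearMap

theorem simplexMap_eq_edgeMap {n : ℕ} (P : Fin (n + 1) → E) (x : Fin n → ℝ) :
    simplexMap P x = P 0 + edgeMap P (WithLp.toLp 2 x) := rfl

/-- The factor between the surface measure of the simplex with vertices `P` and
`simplexMeasure P`, that is, `n!` times the `n`-dimensional volume of the simplex. -/
def content {n : ℕ} (P : Fin (n + 1) → E) : ℝ := (edgeMap P).normDet

theorem content_nonneg {n : ℕ} (P : Fin (n + 1) → E) : 0 ≤ content P := LinearMap.normDet_nonneg _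

theorem content_sq {n : ℕ} (P : Fin (n + 1) → E) :
    content P ^ 2 = (Matrix.gram ℝ fun i : Fin n => P i.succ - P 0).det := by
  have h := (edgeMap P).normDet_sq_eq_det_gram (EuclideanSpace.basisFun (Fin n) ℝ)
  simpa [content, edgeMap, Fintype.linearCombination_apply, Pi.single_apply] using h

variable [MeasurableSpace E] [BorelSpace E]

theorem restrict_convexHull_eq_smul_simplexMeasure {n : ℕ} (P : Fin (n + 1) → E) :
    μHE[n].restrict (convexHull ℝ (Set.range P)) =
      ENNReal.ofReal (content P) • simplexMeasure P := by
  ext s hs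
  have himage : s ∩ convexHull ℝ (Set.range P) = (P 0 + ·) '' (edgeMap P ''
      (WithLp.ofLp ⁻¹' (simplexMap P ⁻¹' s ∩ cornerSimplex n))) := by
    rw [← simplexMap_image, ← Set.image_preimage_inter]
    ext y
    simp only [simplexMap_eq_edgeMap, Set.mem_image, Set.mem_preimage, exists_exists_and_eq_and,
      (WithLp.equiv 2 (Fin n → ℝ)).symm.surjective.exists, WithLp.equiv_symm_apply]
  have harea := (edgeMap P).euclideanHausdorffMeasure_image_eq_normDet_mul_volume
    (WithLp.ofLp ⁻¹' (simplexMap P ⁻¹' s ∩ cornerSimplex n))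
  have hmeas : MeasurableSet (simplexMap P ⁻¹' s ∩ cornerSimplex n) :=
    ((continuous_simplexMap P).measurable hs).inter (measurableSet_cornerSimplex n)
  rw [finrank_euclideanSpace_fin, (PiLp.volume_preserving_ofLp (Fin n)).measure_preimage
    hmeas.nullMeasurableSet] at harea
  rw [Measure.restrict_apply hs, himage,
    (isometry_add_left (P 0)).euclideanHausdorffMeasure_image, harea, Measure.smul_apply,
    simplexMeasure, Measure.map_apply (continuous_simplexMap P).measurable hs,
    Measure.restrict_apply ((continuous_simplexMap P).measurable hs), smul_eq_mul, content]

theorem content_eq_of_range_eq {n : ℕ} {P Q : Fin (n + 1) → E} (h : Set.range P = Set.range Q) :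
    content P = content Q := by
  have hmass (P : Fin (n + 1) → E) : μHE[n] (convexHull ℝ (Set.range P)) =
      ENNReal.ofReal (content P) * volume (cornerSimplex n) := by
    rw [← Measure.restrict_apply_univ, restrict_convexHull_eq_smul_simplexMeasure,
      Measure.smul_apply, simplexMeasure_univ, smul_eq_mul]
  have hmul := hmass P
  rw [h, hmass Q, ENNReal.mul_left_inj (volume_cornerSimplex_ne_zero n)
    (isCompact_cornerSimplex n).measure_lt_top.ne,
    ENNReal.ofReal_eq_ofReal_iff (content_nonneg Q) (content_nonneg P)] at hmul
  exact hmul.symm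

variable {F : Type*} [NormedAddCommGroup F] {n : ℕ} {P : Fin (n + 1) → E} {g : E → F}

theorem integrableOn_convexHull_range (hg : ContinuousOn g (convexHull ℝ (Set.range P))) :
    IntegrableOn g (convexHull ℝ (Set.range P)) μHE[n] := by
  rw [IntegrableOn, restrict_convexHull_eq_smul_simplexMeasure]
  exact (integrable_simplexMeasure hg).smul_measure ENNReal.ofReal_ne_top

theorem setIntegral_convexHull_range [NormedSpace ℝ F] :
    ∫ r in convexHull ℝ (Set.range P), g r ∂μHE[n] = content P • ∫ r, g r ∂simplexMeasure P := by
  rw [restrict_convexHull_eq_smul_simplexMeasure, integral_smul_measure,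
    ENNReal.toReal_ofReal (content_nonneg P)]

end

section

variable {E : Type*} [NormedAddCommGroup E] [InnerProductSpace ℝ E]

theorem det_gram_succ {n : ℕ} {b : Fin (n + 1) → E} {ν : E}
    (hmem : ν ∈ Submodule.span ℝ (Set.range b)) (hnorm : ‖ν‖ = 1)
    (horth : ∀ k : Fin n, inner ℝ ν (b k.succ) = 0) :
    (Matrix.gram ℝ b).det = inner ℝ ν (b 0) ^ 2 * (Matrix.gram ℝ (Fin.tail b)).det := by
  obtain ⟨d, hd⟩ := (Submodule.mem_span_range_iff_exists_fun ℝ).1 hmem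
  have hinner : (fun k => inner ℝ ν (b k)) = Pi.single 0 (inner ℝ ν (b 0)) := by
    ext k
    refine Fin.cases ?_ (fun j => ?_) k <;> simp [horth]
  have hcoeff : d 0 * inner ℝ ν (b 0) = 1 := by
    have hνν : inner ℝ ν ν = 1 := by rw [real_inner_self_eq_norm_sq, hnorm, one_pow]
    nth_rw 2 [← hd] at hνν
    simpa [Fin.sum_univ_succ, inner_add_right, inner_sum, inner_smul_right, horth] using hνν
  have hrow : ∑ k, d k • Matrix.gram ℝ b k = Pi.single 0 (inner ℝ ν (b 0)) := by
    rw [← hinner, ← hd]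
    ext j
    simp [sum_inner, real_inner_smul_left]
  have hminor : d 0 * (Matrix.gram ℝ b).det =
      inner ℝ ν (b 0) * (Matrix.gram ℝ (Fin.tail b)).det := by
    have hsub : (((Matrix.gram ℝ b).updateRow 0 (Pi.single 0 (inner ℝ ν (b 0)))).submatrix
        Fin.succ Fin.succ) = Matrix.gram ℝ (Fin.tail b) := by
      ext i j
      simp [Matrix.gram, Fin.tail]
    rw [← smul_eq_mul, ← Matrix.det_updateRow_sum, hrow, Matrix.det_succ_row_zero,
      Fin.sum_univ_succ]
    simp [hsub]
  linear_combination inner ℝ ν (b 0) * hminor - (Matrix.gram ℝ b).det * hcoeff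

/-- `ν` is the unit normal, within the affine span of the simplex with vertices `P`, of the facet
opposite to `P i`, and points away from `P i`. -/
structure IsOutwardNormal {ι : Type*} (P : ι → E) (i : ι) (ν : E) : Prop where
  norm_eq_one : ‖ν‖ = 1
  mem_vectorSpan : ν ∈ vectorSpan ℝ (Set.range P)
  inner_sub_eq_zero : ∀ ⦃j k⦄, j ≠ i → k ≠ i → inner ℝ ν (P j - P k) = 0
  inner_sub_pos : ∀ ⦃j⦄, j ≠ i → 0 < inner ℝ ν (P j - P i)

theorem IsOutwardNormal.comp_equiv {ι κ : Type*} {P : ι → E} {ν : E} (σ : κ ≃ ι) {i : κ}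
    (h : IsOutwardNormal P (σ i) ν) : IsOutwardNormal (P ∘ σ) i ν where
  norm_eq_one := h.norm_eq_one
  mem_vectorSpan := by rw [σ.surjective.range_comp]; exact h.mem_vectorSpan
  inner_sub_eq_zero _ _ hj hk := h.inner_sub_eq_zero (σ.injective.ne hj) (σ.injective.ne hk)
  inner_sub_pos _ hj := h.inner_sub_pos (σ.injective.ne hj)

theorem IsOutwardNormal.content_eq_zero_one {n : ℕ} {P : Fin (n + 2) → E} {ν : E}
    (h : IsOutwardNormal P 1 ν) :
    content P = inner ℝ ν (P 0 - P 1) * content (P ∘ (1 : Fin (n + 2)).succAbove) := by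
  have hsucc (i : Fin n) : (1 : Fin (n + 2)).succAbove i.succ = i.succ.succ := by
    rw [← Fin.succ_zero_eq_one, Fin.succ_succAbove_succ, Fin.succAbove_zero]
  have hspan : ν ∈ Submodule.span ℝ (Set.range fun i : Fin (n + 1) => P i.succ - P 0) := by
    have hmem := h.mem_vectorSpan
    rw [vectorSpan_range_eq_span_range_vsub_right ℝ P 0, Fin.range_fin_succ] at hmem
    simpa only [Fin.tail_def, vsub_eq_sub, sub_self, Submodule.span_insert_zero] using hmem
  refine (sq_eq_sq₀ (content_nonneg P)
    (mul_nonneg (h.inner_sub_pos zero_ne_one).le (content_nonneg _))).1 ?_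
  rw [mul_pow, content_sq, content_sq, det_gram_succ hspan h.norm_eq_one
    fun k => h.inner_sub_eq_zero (Fin.succ_succ_ne_one k) zero_ne_one, ← neg_sub, inner_neg_right,
    neg_sq]
  simp [hsucc, Fin.tail_def]

theorem exists_perm_zero_one {n : ℕ} {i j : Fin (n + 2)} (hij : i ≠ j) :
    ∃ σ : Equiv.Perm (Fin (n + 2)), σ 0 = i ∧ σ 1 = j := by
  have hne : Equiv.swap 0 i 1 ≠ i := fun h => by
    simpa using (Equiv.swap 0 i).injective (h.trans (Equiv.swap_apply_left 0 i).symm)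
  refine ⟨(Equiv.swap 0 i).trans (Equiv.swap (Equiv.swap 0 i 1) j), ?_, ?_⟩
  · rw [Equiv.trans_apply, Equiv.swap_apply_left, Equiv.swap_apply_of_ne_of_ne hne.symm hij]
  · rw [Equiv.trans_apply, Equiv.swap_apply_left]

theorem range_comp_perm_succAbove {α : Type*} {n : ℕ} (P : Fin (n + 1) → α)
    (σ : Equiv.Perm (Fin (n + 1))) (i : Fin (n + 1)) :
    Set.range ((P ∘ σ) ∘ i.succAbove) = Set.range (P ∘ (σ i).succAbove) := by
  rw [Set.range_comp, Fin.range_succAbove, Set.image_comp, Set.image_compl_eq σ.bijective,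
    Set.image_singleton, Set.range_comp, Fin.range_succAbove]

theorem IsOutwardNormal.content_eq [MeasurableSpace E] [BorelSpace E] {n : ℕ} {P : Fin (n + 2) → E}
    {i j : Fin (n + 2)} {ν : E} (h : IsOutwardNormal P i ν) (hij : i ≠ j) :
    content P = inner ℝ ν (P j - P i) * content (P ∘ i.succAbove) := by
  obtain ⟨σ, rfl, rfl⟩ := exists_perm_zero_one hij.symm
  rw [← content_eq_of_range_eq (σ.surjective.range_comp P), (h.comp_equiv σ).content_eq_zero_one,
    content_eq_of_range_eq (range_comp_perm_succAbove P σ 1), Function.comp_apply,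
    Function.comp_apply]

end

/-- The facet opposite to `P i` of the simplex with vertices `P`. -/
def facet {ι E : Type*} [AddCommGroup E] [Module ℝ E] (P : ι → E) (i : ι) : Set E :=
  convexHull ℝ (P '' {j | j ≠ i})

section

variable {E : Type*} [AddCommGroup E] [Module ℝ E]

theorem facet_eq_convexHull_range {n : ℕ} (P : Fin (n + 1) → E) (i : Fin (n + 1)) :
    facet P i = convexHull ℝ (Set.range (P ∘ i.succAbove)) := by
  rw [facet, Set.range_comp, Fin.range_succAbove]
  rfl

theorem facet_comp_perm {n : ℕ} (P : Fin (n + 1) → E) (σ : Equiv.Perm (Fin (n + 1)))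
    (i : Fin (n + 1)) : facet (P ∘ σ) i = facet P (σ i) := by
  rw [facet_eq_convexHull_range, facet_eq_convexHull_range, range_comp_perm_succAbove]

theorem facet_subset_convexHull {ι : Type*} (P : ι → E) (i : ι) :
    facet P i ⊆ convexHull ℝ (Set.range P) :=
  convexHull_mono (Set.image_subset_range _ _)

end

section

variable {E F : Type*} [NormedAddCommGroup E] [InnerProductSpace ℝ E] [MeasurableSpace E]
  [BorelSpace E] [NormedAddCommGroup F] {n : ℕ} {P : Fin (n + 2) → E} {g : E → F}

theorem integrableOn_facet {i : Fin (n + 2)} (hg : ContinuousOn g (facet P i)) :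
    IntegrableOn g (facet P i) μHE[n] := by
  rw [facet_eq_convexHull_range] at hg ⊢
  exact integrableOn_convexHull_range hg

variable [NormedSpace ℝ F] [CompleteSpace F]

theorem setIntegral_fderiv_edge_zero_one {ν₀ ν₁ : E} (hν₀ : IsOutwardNormal P 0 ν₀)
    (hν₁ : IsOutwardNormal P 1 ν₁) (hg : ∀ r ∈ convexHull ℝ (Set.range P), ContDiffAt ℝ 1 g r) :
    ∫ r in convexHull ℝ (Set.range P), fderiv ℝ g r (P 1 - P 0) ∂μHE[n + 1] =
      inner ℝ ν₀ (P 1 - P 0) • ∫ r in facet P 0, g r ∂μHE[n] +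
        inner ℝ ν₁ (P 1 - P 0) • ∫ r in facet P 1, g r ∂μHE[n] := by
  rw [facet_eq_convexHull_range, facet_eq_convexHull_range, setIntegral_convexHull_range,
    setIntegral_convexHull_range, setIntegral_convexHull_range,
    integral_fderiv_edge_simplexMeasure hg, smul_sub, smul_smul, smul_smul,
    ← hν₀.content_eq zero_ne_one, ← neg_sub (P 0), inner_neg_right, neg_mul,
    ← hν₁.content_eq one_ne_zero, neg_smul, ← sub_eq_add_neg]

theorem setIntegral_fderiv_edge {ν : Fin (n + 2) → E} (hν : ∀ i, IsOutwardNormal P i (ν i))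
    (hg : ∀ r ∈ convexHull ℝ (Set.range P), ContDiffAt ℝ 1 g r) {i j : Fin (n + 2)} (hij : i ≠ j) :
    ∫ r in convexHull ℝ (Set.range P), fderiv ℝ g r (P i - P j) ∂μHE[n + 1] =
      ∑ k, inner ℝ (ν k) (P i - P j) • ∫ r in facet P k, g r ∂μHE[n] := by
  obtain ⟨σ, rfl, rfl⟩ := exists_perm_zero_one hij.symm
  have hrange : Set.range (P ∘ σ) = Set.range P := σ.surjective.range_comp P
  have hedge := setIntegral_fderiv_edge_zero_one ((hν (σ 0)).comp_equiv σ)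
    ((hν (σ 1)).comp_equiv σ) (hrange ▸ hg)
  rw [hrange, facet_comp_perm, facet_comp_perm] at hedge
  rw [Finset.sum_eq_add (σ 0) (σ 1) hij.symm (fun k _ hk => ?_) (by simp) (by simp)]
  · exact hedge
  · rw [(hν k).inner_sub_eq_zero hk.2.symm hk.1.symm, zero_smul]

theorem setIntegral_fderiv_convexHull_range {ν : Fin (n + 2) → E}
    (hν : ∀ i, IsOutwardNormal P i (ν i))
    (hg : ∀ r ∈ convexHull ℝ (Set.range P), ContDiffAt ℝ 1 g r) {v : E}
    (hv : v ∈ vectorSpan ℝ (Set.range P)) :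
    ∫ r in convexHull ℝ (Set.range P), fderiv ℝ g r v ∂μHE[n + 1] =
      ∑ i, inner ℝ (ν i) v • ∫ r in facet P i, g r ∂μHE[n] := by
  have hint (w : E) :
      Integrable (fun r => fderiv ℝ g r w) (μHE[n + 1].restrict (convexHull ℝ (Set.range P))) :=
    integrableOn_convexHull_range fun r hr =>
      (((hg r hr).continuousAt_fderiv one_ne_zero).clm_apply continuousAt_const).continuousWithinAt
  rw [vectorSpan_range_eq_span_range_vsub_right ℝ P 0] at hv
  induction hv using Submodule.span_induction with
  | mem w hw =>
    obtain ⟨i, rfl⟩ := hw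
    obtain rfl | hi := eq_or_ne i 0
    · simp
    · exact setIntegral_fderiv_edge hν hg hi
  | zero => simp
  | add w w' _ _ hw hw' =>
    simp only [map_add, inner_add_right, add_smul, Finset.sum_add_distrib, ← hw, ← hw']
    exact integral_add (hint w) (hint w')
  | smul c w _ hw =>
    simp only [map_smul, inner_smul_right, mul_smul, ← Finset.smul_sum, ← hw]
    exact integral_smul c _

end

section

variable {E : Type*} [NormedAddCommGroup E] [InnerProductSpace ℝ E] [MeasurableSpace E]
  [BorelSpace E] [CompleteSpace E] {n : ℕ} {P ν : Fin (n + 2) → E}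

theorem setIntegral_divergence_convexHull_range {κ : Type*} [Fintype κ] {b : κ → E}
    (hb : ∀ k, b k ∈ vectorSpan ℝ (Set.range P))
    (hbP : ∀ v ∈ vectorSpan ℝ (Set.range P), ∑ k, inner ℝ v (b k) • b k = v)
    (hν : ∀ i, IsOutwardNormal P i (ν i)) {Φ : E → E}
    (hΦ : ∀ r ∈ convexHull ℝ (Set.range P), ContDiffAt ℝ 1 Φ r) :
    ∫ r in convexHull ℝ (Set.range P), ∑ k, inner ℝ (b k) (fderiv ℝ Φ r (b k)) ∂μHE[n + 1] =
      ∑ i, ∫ r in facet P i, inner ℝ (ν i) (Φ r) ∂μHE[n] := by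
  have hderiv (k) : IntegrableOn (fun r => fderiv ℝ Φ r (b k)) (convexHull ℝ (Set.range P))
      μHE[n + 1] :=
    integrableOn_convexHull_range fun r hr =>
      (((hΦ r hr).continuousAt_fderiv one_ne_zero).clm_apply continuousAt_const).continuousWithinAt
  have hfacet (i) : IntegrableOn Φ (facet P i) μHE[n] :=
    integrableOn_facet fun r hr =>
      (hΦ r (facet_subset_convexHull P i hr)).continuousAt.continuousWithinAt
  rw [integral_finsetSum _ fun k _ => (hderiv k).const_inner (b k)]
  simp_rw [integral_inner (hderiv _), integral_inner (hfacet _),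
    setIntegral_fderiv_convexHull_range hν hΦ (hb _), inner_sum, inner_smul_right]
  rw [Finset.sum_comm]
  refine Finset.sum_congr rfl fun i _ => ?_
  conv_rhs => rw [← hbP (ν i) (hν i).mem_vectorSpan]
  simp_rw [sum_inner, real_inner_smul_left]

end

/-! ### Unit normals -/

theorem inner_eq (a b : E3) : inner ℝ a b = a 0 * b 0 + a 1 * b 1 + a 2 * b 2 := by
  simp [PiLp.inner_apply, Fin.sum_univ_three, mul_comm]

theorem cross_zero (a b : E3) : cross a b 0 = a 1 * b 2 - a 2 * b 1 := by
  simp [cross, cross_apply]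

theorem cross_one (a b : E3) : cross a b 1 = a 2 * b 0 - a 0 * b 2 := by
  simp [cross, cross_apply]

theorem cross_two (a b : E3) : cross a b 2 = a 0 * b 1 - a 1 * b 0 := by
  simp [cross, cross_apply]

theorem norm_cross_sq (a b : E3) : ‖cross a b‖ ^ 2 = ‖a‖ ^ 2 * ‖b‖ ^ 2 - inner ℝ a b ^ 2 := by
  simp only [← real_inner_self_eq_norm_sq, inner_eq, cross_zero, cross_one, cross_two]
  ring

theorem inner_self_cross (a b : E3) : inner ℝ a (cross a b) = 0 := by
  simp only [inner_eq, cross_zero, cross_one, cross_two]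
  ring

theorem inner_cross_self (a b : E3) : inner ℝ b (cross a b) = 0 := by
  simp only [inner_eq, cross_zero, cross_one, cross_two]
  ring

theorem inner_cross_cyclic (a b c : E3) : inner ℝ (cross a b) c = inner ℝ b (cross c a) := by
  simp only [inner_eq, cross_zero, cross_one, cross_two]
  ring

theorem cross_smul_smul (c d : ℝ) (a b : E3) : cross (c • a) (d • b) = (c * d) • cross a b := by
  simp [cross, smul_smul, mul_comm]

theorem norm_unit {v : E3} (hv : v ≠ 0) : ‖unit v‖ = 1 := norm_smul_inv_norm hv

theorem norm_smul_unit {v : E3} (hv : v ≠ 0) : ‖v‖ • unit v = v :=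
  smul_inv_smul₀ (norm_ne_zero_iff.2 hv) v

theorem unit_smul {c : ℝ} (hc : 0 < c) (v : E3) : unit (c • v) = unit v := by
  rw [unit, unit, norm_smul, norm_of_nonneg hc.le, smul_smul, mul_inv, mul_comm c⁻¹, mul_assoc,
    inv_mul_cancel₀ hc.ne', mul_one]

/-- A normal vector of the triangle with nodes `P`, not normalized. -/
def triangleNormal (P : Fin 3 → E3) : E3 := cross (P 1 - P 0) (P 2 - P 0)

theorem cross_sub_sub (P : Fin 3 → E3) (l : Fin 3) :
    cross (P (l + 1) - P l) (P (l - 1) - P (l + 1)) = triangleNormal P := by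
  have key (a b c : E3) : cross (b - a) (c - b) = cross (c - b) (a - c) := by
    ext i
    fin_cases i <;>
      simp only [Fin.zero_eta, Fin.mk_one, Fin.reduceFinMk, cross_zero, cross_one, cross_two,
        PiLp.sub_apply] <;>
      ring
  have h0 : cross (P 1 - P 0) (P 2 - P 1) = triangleNormal P := by
    ext i
    fin_cases i <;>
      simp only [Fin.zero_eta, Fin.mk_one, Fin.reduceFinMk, triangleNormal, cross_zero, cross_one,
        cross_two, PiLp.sub_apply] <;>
      ring
  fin_cases l
  · exact h0
  · exact (key _ _ _).symm.trans h0
  · exact (key _ _ _).trans h0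

theorem inner_triangleNormal_sub (P : Fin 3 → E3) (i j : Fin 3) :
    inner ℝ (triangleNormal P) (P i - P j) = 0 := by
  have h (i : Fin 3) : inner ℝ (triangleNormal P) (P i - P 0) = 0 := by
    rw [real_inner_comm]
    fin_cases i
    · simp
    · exact inner_self_cross _ _
    · exact inner_cross_self _ _
  rw [← sub_sub_sub_cancel_right _ _ (P 0), inner_sub_right, h, h, sub_zero]

theorem triangleNormal_ne_zero {P : Fin 3 → E3} (hP : AffineIndependent ℝ P) :
    triangleNormal P ≠ 0 := by
  have hli : LinearIndependent ℝ ![(P 1 - P 0).ofLp, (P 2 - P 0).ofLp] := by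
    have h := ((affineIndependent_iff_linearIndependent_vsub ℝ P 0).1 hP).comp
      ![⟨1, by decide⟩, ⟨2, by decide⟩] (by decide)
    have hfun : ![(P 1 - P 0).ofLp, (P 2 - P 0).ofLp] = WithLp.linearEquiv 2 ℝ (Fin 3 → ℝ) ∘
        (fun i : {i : Fin 3 // i ≠ 0} => P i -ᵥ P 0) ∘ ![⟨1, by decide⟩, ⟨2, by decide⟩] := by
      ext i : 1
      fin_cases i <;> rfl
    exact hfun ▸ h.map' (WithLp.linearEquiv 2 ℝ (Fin 3 → ℝ)).toLinearMap (LinearEquiv.ker _)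
  intro h
  exact crossProduct_ne_zero_iff_linearIndependent.2 hli (congrArg WithLp.ofLp h)

section

variable {E : Type*} [NormedAddCommGroup E] [InnerProductSpace ℝ E]

theorem eq_zero_of_mem_vectorSpan_of_inner_sub_eq_zero {ι : Type*} {P : ι → E} {v : E} (i : ι)
    (hv : v ∈ vectorSpan ℝ (Set.range P)) (h : ∀ j, inner ℝ v (P j - P i) = 0) : v = 0 := by
  have hle : vectorSpan ℝ (Set.range P) ≤ (ℝ ∙ v)ᗮ := by
    rw [vectorSpan_range_eq_span_range_vsub_right ℝ P i, Submodule.span_le]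
    rintro _ ⟨j, rfl⟩
    exact Submodule.mem_orthogonal_singleton_iff_inner_right.2 (h j)
  exact inner_self_eq_zero.1 (Submodule.mem_orthogonal_singleton_iff_inner_right.1 (hle hv))

theorem isOutwardNormal_sign_smul {ι : Type*} {P : ι → E} {i j : ι} {v : E}
    (hv : v ∈ vectorSpan ℝ (Set.range P)) (hv0 : v ≠ 0) (hj : j ≠ i)
    (h : ∀ ⦃k l⦄, k ≠ i → l ≠ i → inner ℝ v (P k - P l) = 0) :
    IsOutwardNormal P i (Real.sign (inner ℝ v (P j - P i)) • ‖v‖⁻¹ • v) := by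
  have hconst {k : ι} (hk : k ≠ i) : inner ℝ v (P k - P i) = inner ℝ v (P j - P i) := by
    rw [← sub_eq_zero, ← inner_sub_right, sub_sub_sub_cancel_right, h hk hj]
  have hne : inner ℝ v (P j - P i) ≠ 0 := fun h0 => by
    refine hv0 (eq_zero_of_mem_vectorSpan_of_inner_sub_eq_zero i hv fun k => ?_)
    obtain rfl | hk := eq_or_ne k i
    · simp
    · rw [hconst hk, h0]
  refine ⟨?_, Submodule.smul_mem _ _ (Submodule.smul_mem _ _ hv), fun k l hk hl => ?_,
    fun k hk => ?_⟩
  · rw [norm_smul, norm_smul, norm_inv, norm_norm, inv_mul_cancel₀ (norm_ne_zero_iff.2 hv0)]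
    rcases Real.sign_apply_eq_of_ne_zero _ hne with hs | hs <;> simp [hs]
  · rw [real_inner_smul_left, real_inner_smul_left, h hk hl, mul_zero, mul_zero]
  · rw [real_inner_smul_left, real_inner_smul_left, hconst hk, mul_left_comm]
    exact mul_pos (inv_pos.2 (norm_pos_iff.2 hv0)) (Real.sign_mul_pos_of_ne_zero _ hne)

theorem vectorSpan_range_eq_top {ι : Type*} (p : AffineBasis ι ℝ E) :
    vectorSpan ℝ (Set.range p) = ⊤ := by
  rw [← direction_affineSpan, p.tot, AffineSubspace.direction_top]

end

theorem isOutwardNormal_outwardNormal (p : AffineBasis (Fin 4) ℝ E3) (i : Fin 4) :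
    IsOutwardNormal p i (outwardNormal p i) := by
  refine isOutwardNormal_sign_smul (by rw [vectorSpan_range_eq_top]; trivial)
    (triangleNormal_ne_zero (p.ind.comp_embedding i.succAboveEmb))
    (Fin.succAbove_ne i 0) fun k l hk hl => ?_
  obtain ⟨k, rfl⟩ := Fin.exists_succAbove_eq hk
  obtain ⟨l, rfl⟩ := Fin.exists_succAbove_eq hl
  exact inner_triangleNormal_sub (p ∘ i.succAbove) k l

theorem inner_wHat_mHat (P : Fin 3 → E3) (l : Fin 3) : inner ℝ (wHat P) (mHat P l) = 0 :=
  inner_cross_self _ _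

theorem inner_sHat_mHat (P : Fin 3 → E3) (l : Fin 3) : inner ℝ (sHat P l) (mHat P l) = 0 :=
  inner_self_cross _ _

section

variable {P : Fin 3 → E3} (hP : AffineIndependent ℝ P)
include hP

theorem side_ne_zero (l : Fin 3) : P (l - 1) - P (l + 1) ≠ 0 :=
  sub_ne_zero.2 (hP.injective.ne (by revert l; decide))

theorem norm_sHat (l : Fin 3) : ‖sHat P l‖ = 1 := norm_unit (side_ne_zero hP l)

theorem norm_smul_sHat (l : Fin 3) :
    ‖P (l - 1) - P (l + 1)‖ • sHat P l = P (l - 1) - P (l + 1) :=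
  norm_smul_unit (side_ne_zero hP l)

theorem wHat_eq : wHat P = unit (triangleNormal P) := by
  have h0 := norm_pos_iff.2 (side_ne_zero hP 0)
  have h1 := norm_pos_iff.2 (side_ne_zero hP 1)
  rw [wHat, sHat, sHat, unit.eq_def (P _ - _), unit.eq_def (P _ - _), cross_smul_smul,
    unit_smul (by positivity)]
  exact congrArg unit (cross_sub_sub P 1)

theorem norm_wHat : ‖wHat P‖ = 1 := by
  rw [wHat_eq hP, norm_unit (triangleNormal_ne_zero hP)]

theorem mem_vectorSpan_iff_inner_wHat_eq_zero {v : E3} :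
    v ∈ vectorSpan ℝ (Set.range P) ↔ inner ℝ (wHat P) v = 0 := by
  have hle : vectorSpan ℝ (Set.range P) ≤ (ℝ ∙ wHat P)ᗮ := by
    rw [vectorSpan_range_eq_span_range_vsub_right ℝ P 0, Submodule.span_le]
    rintro _ ⟨j, rfl⟩
    rw [SetLike.mem_coe, Submodule.mem_orthogonal_singleton_iff_inner_right, wHat_eq hP, unit,
      real_inner_smul_left]
    exact mul_eq_zero_of_right _ (inner_triangleNormal_sub P j 0)
  have : Fact (Module.finrank ℝ E3 = 2 + 1) := ⟨by simp⟩
  have hw : wHat P ≠ 0 := norm_ne_zero_iff.1 (by rw [norm_wHat hP]; exact one_ne_zero)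
  have hfinrank : Module.finrank ℝ (vectorSpan ℝ (Set.range P)) =
      Module.finrank ℝ ((ℝ ∙ wHat P)ᗮ : Submodule ℝ E3) := by
    rw [hP.finrank_vectorSpan (n := 2) (by simp),
      Submodule.finrank_orthogonal_span_singleton (n := 2) hw]
  rw [Submodule.eq_of_le_of_finrank_eq hle hfinrank,
    Submodule.mem_orthogonal_singleton_iff_inner_right]

theorem inner_wHat_sub (i j : Fin 3) : inner ℝ (wHat P) (P i - P j) = 0 :=
  (mem_vectorSpan_iff_inner_wHat_eq_zero hP).1
    (vsub_mem_vectorSpan ℝ (Set.mem_range_self i) (Set.mem_range_self j))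

theorem inner_wHat_sHat (l : Fin 3) : inner ℝ (wHat P) (sHat P l) = 0 := by
  rw [sHat, unit, inner_smul_right, inner_wHat_sub hP, mul_zero]

theorem norm_mHat (l : Fin 3) : ‖mHat P l‖ = 1 := by
  rw [← sq_eq_sq₀ (norm_nonneg _) zero_le_one, mHat, norm_cross_sq, norm_sHat hP, norm_wHat hP,
    real_inner_comm, inner_wHat_sHat hP]
  norm_num

theorem orthonormal_frame (l : Fin 3) : Orthonormal ℝ ![sHat P l, mHat P l, wHat P] := by
  have hsw := (real_inner_comm _ _).trans (inner_wHat_sHat hP l)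
  have hmw := (real_inner_comm _ _).trans (inner_wHat_mHat P l)
  simp [orthonormal_vecCons_iff, Fin.forall_fin_two, norm_sHat hP, norm_mHat hP, norm_wHat hP,
    inner_sHat_mHat, hsw, hmw]

theorem inner_mHat_sub (l : Fin 3) : inner ℝ (mHat P l) (P (l - 1) - P (l + 1)) = 0 := by
  rw [← norm_smul_sHat hP, inner_smul_right, real_inner_comm, inner_sHat_mHat, mul_zero]

theorem inner_mHat_sub_pos (l : Fin 3) : 0 < inner ℝ (mHat P l) (P (l + 1) - P l) := by
  have hN := norm_pos_iff.2 (triangleNormal_ne_zero hP)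
  have hside := norm_pos_iff.2 (side_ne_zero hP l)
  rw [mHat, sHat, wHat_eq hP, unit, unit, cross_smul_smul, real_inner_smul_left,
    inner_cross_cyclic, cross_sub_sub, real_inner_self_eq_norm_sq]
  positivity

theorem isOutwardNormal_mHat (l : Fin 3) : IsOutwardNormal P l (mHat P l) := by
  have hcases : ∀ {l j : Fin 3}, j ≠ l → j = l + 1 ∨ j = l - 1 := by decide
  have hflat := inner_mHat_sub hP l
  refine ⟨norm_mHat hP l,
    (mem_vectorSpan_iff_inner_wHat_eq_zero hP).2 (inner_wHat_mHat P l), fun j k hj hk => ?_,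
    fun j hj => ?_⟩
  · rcases hcases hj with rfl | rfl <;> rcases hcases hk with rfl | rfl
    · simp
    · rw [← neg_sub, inner_neg_right, hflat, neg_zero]
    · exact hflat
    · simp
  · rcases hcases hj with rfl | rfl
    · exact inner_mHat_sub_pos hP l
    · rw [← sub_add_sub_cancel _ (P (l + 1)), inner_add_right, hflat, zero_add]
      exact inner_mHat_sub_pos hP l

theorem frame_expansion (l : Fin 3) (v : E3) :
    inner ℝ v (sHat P l) • sHat P l + inner ℝ v (mHat P l) • mHat P l +
      inner ℝ v (wHat P) • wHat P = v := by
  obtain ⟨b, hb⟩ := Orthonormal.exists_orthonormalBasis_extension_of_card_eq (ι := Fin 3)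
    (by simp) (v := ![sHat P l, mHat P l, wHat P]) (s := Set.univ)
    ((orthonormal_frame hP l).comp _ Subtype.val_injective)
  have h := b.sum_repr' v
  simp only [hb _ (Set.mem_univ _), Fin.sum_univ_three] at h
  simpa [real_inner_comm v] using h

theorem tangent_frame_expansion (l : Fin 3) {v : E3} (hv : v ∈ vectorSpan ℝ (Set.range P)) :
    ∑ k, inner ℝ v (![sHat P l, mHat P l] k) • ![sHat P l, mHat P l] k = v := by
  have hw := (real_inner_comm _ _).trans ((mem_vectorSpan_iff_inner_wHat_eq_zero hP).1 hv)
  simpa [Fin.sum_univ_two, hw] using frame_expansion hP l v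

theorem tangent_frame_mem_vectorSpan (l : Fin 3) (k : Fin 2) :
    ![sHat P l, mHat P l] k ∈ vectorSpan ℝ (Set.range P) := by
  rw [mem_vectorSpan_iff_inner_wHat_eq_zero hP]
  fin_cases k
  · exact inner_wHat_sHat hP l
  · exact inner_wHat_mHat P l

end

/-! ### Sides of a triangle -/

theorem setIntegral_image_Icc_of_isometry {E F : Type*} [MetricSpace E] [MeasurableSpace E]
    [BorelSpace E] [NormedAddCommGroup F] [NormedSpace ℝ F] {γ : ℝ → E} (hγ : Isometry γ) {a b : ℝ}
    (hab : a ≤ b) (g : E → F) :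
    ∫ r in γ '' Set.Icc a b, g r ∂μHE[1] = ∫ s in a..b, g (γ s) := by
  have hvol : (μHE[1] : Measure ℝ) = volume := by
    rw [← Module.finrank_self ℝ]
    exact InnerProductSpace.euclideanHausdorffMeasure_eq_volume
  rw [intervalIntegral.integral_of_le hab, ← integral_Icc_eq_integral_Ioc, ← hvol,
    ← Measure.restrict_restrict_of_subset (Set.image_subset_range γ _),
    ← hγ.map_euclideanHausdorffMeasure,
    hγ.isClosedEmbedding.measurableEmbedding.setIntegral_map, hγ.injective.preimage_image]

/-- The point with arc length coordinate `s` on the line of side `l`, measured from the foot of the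
perpendicular from `r₀`. -/
def sidePoint (P : Fin 3 → E3) (r0 : E3) (l : Fin 3) (s : ℝ) : E3 :=
  rho P r0 + t0 P r0 l • mHat P l + s • sHat P l

theorem sidePoint_sub_rho (P : Fin 3 → E3) (r0 : E3) (l : Fin 3) (s : ℝ) :
    sidePoint P r0 l s - rho P r0 = t0 P r0 l • mHat P l + s • sHat P l := by
  rw [sidePoint, add_assoc, add_sub_cancel_left]

section

variable {P : Fin 3 → E3} (hP : AffineIndependent ℝ P) (r0 : E3)
include hP

theorem isometry_sidePoint (l : Fin 3) : Isometry (sidePoint P r0 l) :=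
  Isometry.of_dist_eq fun s s' => by
    rw [dist_eq_norm, dist_eq_norm, sidePoint, sidePoint, add_sub_add_left_eq_sub, ← sub_smul,
      norm_smul, norm_sHat hP, mul_one]

theorem inner_node_sub_rho_wHat (i : Fin 3) : inner ℝ (P i - rho P r0) (wHat P) = 0 := by
  have h := (real_inner_comm _ _).trans (inner_wHat_sub hP i 0)
  rw [← sub_add_sub_cancel _ (P 0), inner_add_left, h, rho, ← sub_sub, inner_sub_left,
    real_inner_smul_left, real_inner_self_eq_norm_sq, norm_wHat hP, w0]
  ring

theorem inner_end_sub_rho_mHat (l : Fin 3) :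
    inner ℝ (P (l - 1) - rho P r0) (mHat P l) = t0 P r0 l := by
  have h := (real_inner_comm _ _).trans (inner_mHat_sub hP l)
  rw [t0, ← sub_add_sub_cancel _ (P (l + 1)), inner_add_left, h, zero_add]

theorem sidePoint_sMinus (l : Fin 3) : sidePoint P r0 l (sMinus P r0 l) = P (l + 1) := by
  have h := frame_expansion hP l (P (l + 1) - rho P r0)
  rw [inner_node_sub_rho_wHat hP, zero_smul, add_zero] at h
  rw [← sub_left_inj (a := rho P r0), sidePoint_sub_rho, add_comm, ← h, sMinus, t0]

theorem sidePoint_sPlus (l : Fin 3) : sidePoint P r0 l (sPlus P r0 l) = P (l - 1) := by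
  have h := frame_expansion hP l (P (l - 1) - rho P r0)
  rw [inner_node_sub_rho_wHat hP, zero_smul, add_zero, inner_end_sub_rho_mHat hP] at h
  rw [← sub_left_inj (a := rho P r0), sidePoint_sub_rho, add_comm, ← h, sPlus]

theorem sMinus_le_sPlus (l : Fin 3) : sMinus P r0 l ≤ sPlus P r0 l := by
  rw [← sub_nonneg, sPlus, sMinus, ← inner_sub_left, sub_sub_sub_cancel_right, ← norm_smul_sHat hP,
    real_inner_smul_left, real_inner_self_eq_norm_sq]
  positivity

theorem facet_eq_image_sidePoint (l : Fin 3) :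
    facet P l = sidePoint P r0 l '' Set.Icc (sMinus P r0 l) (sPlus P r0 l) := by
  have hset : {j | j ≠ l} = {l + 1, l - 1} := by
    ext j
    revert j l
    decide
  have haff : sidePoint P r0 l = AffineMap.lineMap (rho P r0 + t0 P r0 l • mHat P l)
      (rho P r0 + t0 P r0 l • mHat P l + sHat P l) := by
    ext s : 1
    simp [sidePoint, AffineMap.lineMap_apply, add_comm]
  rw [← segment_eq_Icc (sMinus_le_sPlus hP r0 l), haff, image_segment, ← haff,
    sidePoint_sMinus hP, sidePoint_sPlus hP, facet, hset, Set.image_pair, convexHull_pair]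

theorem setIntegral_facet_triangle {F : Type*} [NormedAddCommGroup F] [NormedSpace ℝ F] (l : Fin 3)
    (g : E3 → F) :
    ∫ r in facet P l, g r ∂μHE[1] =
      ∫ s in sMinus P r0 l..sPlus P r0 l, g (sidePoint P r0 l s) := by
  rw [facet_eq_image_sidePoint hP r0, setIntegral_image_Icc_of_isometry
    (isometry_sidePoint hP r0 l) (sMinus_le_sPlus hP r0 l)]

theorem norm_sidePoint_sub (l : Fin 3) (s : ℝ) :
    ‖sidePoint P r0 l s - r0‖ = √(s ^ 2 + t0 P r0 l ^ 2 + w0 P r0 ^ 2) := by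
  have hframe : sidePoint P r0 l s - r0 =
      ∑ k, ![s, t0 P r0 l, w0 P r0] k • ![sHat P l, mHat P l, wHat P] k := by
    simp only [Fin.sum_univ_three, Matrix.cons_val, sidePoint, rho]
    abel
  rw [← Real.sqrt_sq (norm_nonneg _), ← real_inner_self_eq_norm_sq, hframe,
    (orthonormal_frame hP l).inner_sum, Fin.sum_univ_three]
  simp [sq]

theorem inner_mHat_sidePoint_sub_rho (l : Fin 3) (s : ℝ) :
    inner ℝ (mHat P l) (sidePoint P r0 l s - rho P r0) = t0 P r0 l := by
  rw [sidePoint_sub_rho, inner_add_right, inner_smul_right, inner_smul_right,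
    real_inner_self_eq_norm_sq, norm_mHat hP, real_inner_comm, inner_sHat_mHat]
  ring

theorem inner_wHat_sub_of_mem {r : E3} (hr : r ∈ convexHull ℝ (Set.range P)) :
    inner ℝ (wHat P) (r - r0) = w0 P r0 := by
  have hmem : r - P 0 ∈ vectorSpan ℝ (Set.range P) :=
    direction_affineSpan ℝ (Set.range P) ▸ AffineSubspace.vsub_mem_direction
      (convexHull_subset_affineSpan _ hr) (subset_affineSpan ℝ _ (Set.mem_range_self 0))
  rw [← sub_add_sub_cancel r (P 0), inner_add_right,
    (mem_vectorSpan_iff_inner_wHat_eq_zero hP).1 hmem, zero_add, real_inner_comm, w0]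

end

/-! ### Functions of the distance to the source -/

section

variable {E : Type*} [NormedAddCommGroup E] [InnerProductSpace ℝ E] {r0 r : E}

theorem contDiffAt_norm_sub (h : r ≠ r0) : ContDiffAt ℝ 1 (fun r => ‖r - r0‖) r :=
  (contDiffAt_id.sub contDiffAt_const).norm ℝ (sub_ne_zero.2 h)

theorem hasFDerivAt_norm_sub (h : r ≠ r0) :
    HasFDerivAt (fun r => ‖r - r0‖) (‖r - r0‖⁻¹ • innerSL ℝ (r - r0)) r := by
  have hsq := (((hasFDerivAt_id r).sub_const r0).norm_sq).sqrt
    (pow_ne_zero 2 (norm_ne_zero_iff.2 (sub_ne_zero.2 h)))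
  simp only [id, Real.sqrt_sq (norm_nonneg _)] at hsq
  refine hsq.congr_fderiv ?_
  ext v
  simp only [smul_apply, ContinuousLinearMap.comp_id, innerSL_apply_apply, nsmul_eq_mul,
    smul_eq_mul, Nat.cast_ofNat]
  field_simp

theorem hasFDerivAt_comp_norm_sub {φ : ℝ → ℝ} {φ' : ℝ} (h : r ≠ r0)
    (hφ : HasDerivAt φ φ' ‖r - r0‖) :
    HasFDerivAt (fun r => φ ‖r - r0‖) ((φ' * ‖r - r0‖⁻¹) • innerSL ℝ (r - r0)) r := by
  have hcomp := hφ.comp_hasFDerivAt r (hasFDerivAt_norm_sub h)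
  rwa [smul_smul] at hcomp

theorem continuousAt_gradient [CompleteSpace E] {g : E → ℝ} (hg : ContDiffAt ℝ 1 g r) :
    ContinuousAt (∇ g) r :=
  (InnerProductSpace.toDual ℝ E).symm.continuous.continuousAt.comp
    (hg.continuousAt_fderiv one_ne_zero)

end

section

variable {r0 r : E3}

theorem contDiffAt_invDist (h : r ≠ r0) : ContDiffAt ℝ 1 (invDist r0) r :=
  contDiffAt_const.div (contDiffAt_norm_sub h) (norm_ne_zero_iff.2 (sub_ne_zero.2 h))

theorem contDiffAt_dipole (q : E3) (h : r ≠ r0) : ContDiffAt ℝ 1 (dipole q r0) r :=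
  (contDiffAt_const.inner ℝ (contDiffAt_id.sub contDiffAt_const)).div
    ((contDiffAt_norm_sub h).pow 3) (pow_ne_zero 3 (norm_ne_zero_iff.2 (sub_ne_zero.2 h)))

theorem gradient_invDist (h : r ≠ r0) :
    ∇ (invDist r0) r = -(‖r - r0‖ ^ 3)⁻¹ • (r - r0) := by
  have hR := norm_ne_zero_iff.2 (sub_ne_zero.2 h)
  have hinv : invDist r0 = fun r => ‖r - r0‖⁻¹ := funext fun r => one_div _
  have hderiv := (hasFDerivAt_comp_norm_sub h (hasDerivAt_inv hR)).fderiv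
  refine ext_inner_right ℝ fun v => ?_
  rw [inner_gradient_left, hinv, hderiv, real_inner_smul_left, smul_apply,
    innerSL_apply_apply, smul_eq_mul]
  field_simp

theorem dipole_eq_neg_inner_gradient (q : E3) (h : r ≠ r0) :
    dipole q r0 r = -inner ℝ q (∇ (invDist r0) r) := by
  rw [gradient_invDist h, inner_smul_right, dipole]
  ring

end

/-! ### Integrals along a side -/

theorem sqrt_sq_add_add_self_pos {c a s : ℝ} (hc : 0 ≤ c) (ha : √(a ^ 2 + c) + a ≠ 0)
    (has : a ≤ s) : 0 < √(s ^ 2 + c) + s := by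
  rcases hc.eq_or_lt with rfl | hc'
  · have ha' : 0 < a := by
      contrapose! ha
      rw [add_zero, Real.sqrt_sq_eq_abs, abs_of_nonpos ha, neg_add_cancel]
    have hs := ha'.trans_le has
    positivity
  · have hlt : |s| < √(s ^ 2 + c) := Real.lt_sqrt_of_sq_lt (by rw [sq_abs]; linarith)
    linarith [neg_abs_le s]

theorem sqrt_sq_add_ne_zero {c s : ℝ} (hc : 0 ≤ c) (hs : 0 < √(s ^ 2 + c) + s) :
    √(s ^ 2 + c) ≠ 0 := fun h => by
  have hsum := (Real.sqrt_eq_zero (by positivity)).1 h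
  have hs0 : s = 0 := by nlinarith
  rw [h, hs0, add_zero] at hs
  exact lt_irrefl 0 hs

theorem hasDerivAt_log_sqrt_sq_add_add_self {c s : ℝ} (hc : 0 ≤ c) (hs : 0 < √(s ^ 2 + c) + s) :
    HasDerivAt (fun s => Real.log (√(s ^ 2 + c) + s)) (√(s ^ 2 + c))⁻¹ s := by
  have hR := sqrt_sq_add_ne_zero hc hs
  have hne : s ^ 2 + c ≠ 0 := fun h => hR (by rw [h, Real.sqrt_zero])
  have hsq : HasDerivAt (fun s : ℝ => s ^ 2 + c) (2 * s) s := by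
    simpa using (hasDerivAt_pow 2 s).add_const c
  refine (((hsq.sqrt hne).fun_add (hasDerivAt_id' s)).log hs.ne').congr_deriv ?_
  field_simp
  ring

theorem integral_inv_sqrt_sq_add {c a b : ℝ} (hc : 0 ≤ c) (hab : a ≤ b)
    (ha : √(a ^ 2 + c) + a ≠ 0) :
    ∫ s in a..b, (√(s ^ 2 + c))⁻¹ = Real.log ((√(b ^ 2 + c) + b) / (√(a ^ 2 + c) + a)) := by
  have hpos {s : ℝ} (hs : s ∈ Set.uIcc a b) : 0 < √(s ^ 2 + c) + s :=
    sqrt_sq_add_add_self_pos hc ha (Set.uIcc_of_le hab ▸ hs).1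
  have hcont : ContinuousOn (fun s => (√(s ^ 2 + c))⁻¹) (Set.uIcc a b) :=
    ContinuousOn.inv₀ (by fun_prop) fun s hs => sqrt_sq_add_ne_zero hc (hpos hs)
  rw [intervalIntegral.integral_eq_sub_of_hasDerivAt
    (fun s hs => hasDerivAt_log_sqrt_sq_add_add_self hc (hpos hs)) hcont.intervalIntegrable,
    Real.log_div (hpos Set.right_mem_uIcc).ne' (hpos Set.left_mem_uIcc).ne']

theorem hasDerivAt_arctan_side {c : ℝ} (hc : 0 < c) (t s : ℝ) :
    HasDerivAt (fun s => Real.arctan (t * s / (t ^ 2 + c ^ 2 + c * √(s ^ 2 + t ^ 2 + c ^ 2))))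
      (t / (√(s ^ 2 + t ^ 2 + c ^ 2) * (√(s ^ 2 + t ^ 2 + c ^ 2) + c))) s := by
  have hsq : HasDerivAt (fun s : ℝ => s ^ 2 + t ^ 2 + c ^ 2) (2 * s) s := by
    simpa using ((hasDerivAt_pow 2 s).add_const (t ^ 2)).add_const (c ^ 2)
  have hden := ((hsq.sqrt (by positivity)).const_mul c).const_add (t ^ 2 + c ^ 2)
  refine (((hasDerivAt_id' s).const_mul t).fun_div hden (by positivity)).arctan.congr_deriv ?_
  have hR : 0 < √(s ^ 2 + t ^ 2 + c ^ 2) := Real.sqrt_pos.2 (by positivity)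
  have hs : s ^ 2 = √(s ^ 2 + t ^ 2 + c ^ 2) ^ 2 - t ^ 2 - c ^ 2 := by
    rw [Real.sq_sqrt (by positivity)]
    ring
  generalize √(s ^ 2 + t ^ 2 + c ^ 2) = R at hR hs ⊢
  have hquot : 1 + (t * s / (t ^ 2 + c ^ 2 + c * R)) ^ 2 =
      (t ^ 2 + c ^ 2) * (R + c) ^ 2 / (t ^ 2 + c ^ 2 + c * R) ^ 2 := by
    field_simp
    rw [hs]
    ring
  have hnum : t * 1 * (t ^ 2 + c ^ 2 + c * R) - t * s * (c * (2 * s / (2 * R))) =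
      t * (t ^ 2 + c ^ 2) * (R + c) / R := by
    field_simp
    rw [hs]
    ring
  rw [hquot, hnum]
  field_simp

theorem integral_arctan_side {c : ℝ} (hc : 0 < c) (t a b : ℝ) :
    ∫ s in a..b, t / (√(s ^ 2 + t ^ 2 + c ^ 2) * (√(s ^ 2 + t ^ 2 + c ^ 2) + c)) =
      Real.arctan (t * b / (t ^ 2 + c ^ 2 + c * √(b ^ 2 + t ^ 2 + c ^ 2))) -
      Real.arctan (t * a / (t ^ 2 + c ^ 2 + c * √(a ^ 2 + t ^ 2 + c ^ 2))) := by
  refine intervalIntegral.integral_eq_sub_of_hasDerivAt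
    (fun s _ => hasDerivAt_arctan_side hc t s) (Continuous.intervalIntegrable ?_ _ _)
  refine Continuous.div continuous_const (by fun_prop) fun s => ne_of_gt ?_
  positivity

/-! ### Integrals of gradients -/

section

variable {E : Type*} [NormedAddCommGroup E] [InnerProductSpace ℝ E] [MeasurableSpace E]
  [BorelSpace E] [CompleteSpace E] {n : ℕ} {g : E → ℝ}

theorem integrableOn_gradient_convexHull_range {P : Fin (n + 1) → E}
    (hg : ∀ r ∈ convexHull ℝ (Set.range P), ContDiffAt ℝ 1 g r) :
    IntegrableOn (∇ g) (convexHull ℝ (Set.range P)) μHE[n] :=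
  integrableOn_convexHull_range fun r hr => (continuousAt_gradient (hg r hr)).continuousWithinAt

variable {P ν : Fin (n + 2) → E}

theorem inner_setIntegral_gradient_convexHull_range (hν : ∀ i, IsOutwardNormal P i (ν i))
    (hg : ∀ r ∈ convexHull ℝ (Set.range P), ContDiffAt ℝ 1 g r) {v : E}
    (hv : v ∈ vectorSpan ℝ (Set.range P)) :
    inner ℝ v (∫ r in convexHull ℝ (Set.range P), ∇ g r ∂μHE[n + 1]) =
      ∑ i, (∫ r in facet P i, g r ∂μHE[n]) * inner ℝ v (ν i) := by
  rw [← integral_inner (integrableOn_gradient_convexHull_range hg)]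
  simp_rw [real_inner_comm (∇ g _) v, inner_gradient_left,
    setIntegral_fderiv_convexHull_range hν hg hv, smul_eq_mul, real_inner_comm v, mul_comm]

theorem setIntegral_gradient_convexHull_range (hν : ∀ i, IsOutwardNormal P i (ν i))
    (hP : vectorSpan ℝ (Set.range P) = ⊤)
    (hg : ∀ r ∈ convexHull ℝ (Set.range P), ContDiffAt ℝ 1 g r) :
    ∫ r in convexHull ℝ (Set.range P), ∇ g r ∂μHE[n + 1] =
      ∑ i, (∫ r in facet P i, g r ∂μHE[n]) • ν i := by
  refine ext_inner_left ℝ fun v => ?_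
  rw [inner_setIntegral_gradient_convexHull_range hν hg (hP ▸ Submodule.mem_top)]
  simp_rw [inner_sum, inner_smul_right]

end

section

variable {E : Type*} [NormedAddCommGroup E] [InnerProductSpace ℝ E] {r0 r : E}

theorem sum_inner_fderiv_comp_norm_smul_sub {κ : Type*} [Fintype κ] {b : κ → E} {ρ : E}
    (hb : ∀ k, ‖b k‖ = 1) (hexp : ∑ k, inner ℝ (r - ρ) (b k) • b k = r - ρ) (h : r ≠ r0)
    {φ : ℝ → ℝ} {φ' : ℝ} (hφ : HasDerivAt φ φ' ‖r - r0‖) :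
    ∑ k, inner ℝ (b k) (fderiv ℝ (fun r => φ ‖r - r0‖ • (r - ρ)) r (b k)) =
      Fintype.card κ * φ ‖r - r0‖ + φ' * ‖r - r0‖⁻¹ * inner ℝ (r - r0) (r - ρ) := by
  have hsub : HasFDerivAt (fun r => r - ρ) (.id ℝ E) r := (hasFDerivAt_id r).sub_const ρ
  have hfderiv := ((hasFDerivAt_comp_norm_sub h hφ).fun_smul hsub).fderiv
  have hterm (k) : inner ℝ (b k) (fderiv ℝ (fun r => φ ‖r - r0‖ • (r - ρ)) r (b k)) =
      φ ‖r - r0‖ + φ' * ‖r - r0‖⁻¹ * (inner ℝ (r - ρ) (b k) * inner ℝ (r - r0) (b k)) := by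
    rw [hfderiv]
    simp only [add_apply, smul_apply, ContinuousLinearMap.smulRight_apply,
      ContinuousLinearMap.id_apply, innerSL_apply_apply, smul_eq_mul, inner_add_right,
      inner_smul_right, real_inner_self_eq_norm_sq, hb, real_inner_comm (r - ρ) (b k)]
    ring
  have hsum : ∑ k, inner ℝ (r - ρ) (b k) * inner ℝ (r - r0) (b k) = inner ℝ (r - r0) (r - ρ) := by
    conv_rhs => rw [← hexp]
    simp_rw [inner_sum, inner_smul_right]
  simp_rw [hterm, Finset.sum_add_distrib, ← Finset.mul_sum, hsum]
  simp

end

/-- The planar field `(r - ρ) / (R (R + |w₀|))`. Its divergence in the plane of the triangle is the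
density `|w₀| / R³` of the solid angle seen from `r₀`. -/
def solidAngleField (P : Fin 3 → E3) (r0 r : E3) : E3 :=
  (‖r - r0‖ * (‖r - r0‖ + |w0 P r0|))⁻¹ • (r - rho P r0)

theorem sign_mul_abs (x : ℝ) : Real.sign x * |x| = x := by
  obtain hx | rfl | hx := lt_trichotomy x 0
  · rw [Real.sign_of_neg hx, abs_of_neg hx, neg_one_mul, neg_neg]
  · rw [abs_zero, mul_zero]
  · rw [Real.sign_of_pos hx, abs_of_pos hx, one_mul]

theorem hasDerivAt_inv_mul_add {c x : ℝ} (hx : x ≠ 0) (hxc : x + c ≠ 0) :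
    HasDerivAt (fun x => (x * (x + c))⁻¹) (-(2 * x + c) / (x * (x + c)) ^ 2) x := by
  refine (((hasDerivAt_id' x).fun_mul ((hasDerivAt_id' x).add_const c)).fun_inv
    (mul_ne_zero hx hxc)).congr_deriv ?_
  ring

section

variable {P : Fin 3 → E3} {r0 r : E3}

theorem contDiffAt_solidAngleField (P : Fin 3 → E3) (h : r ≠ r0) :
    ContDiffAt ℝ 1 (solidAngleField P r0) r := by
  have hR := norm_pos_iff.2 (sub_ne_zero.2 h)
  exact (((contDiffAt_norm_sub h).mul ((contDiffAt_norm_sub h).add contDiffAt_const)).inv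
    (by positivity)).smul (contDiffAt_id.sub contDiffAt_const)

variable (hP : AffineIndependent ℝ P)
include hP

theorem sub_rho_mem_vectorSpan (hr : r ∈ convexHull ℝ (Set.range P)) :
    r - rho P r0 ∈ vectorSpan ℝ (Set.range P) := by
  rw [mem_vectorSpan_iff_inner_wHat_eq_zero hP, rho, ← sub_sub, inner_sub_right,
    inner_wHat_sub_of_mem hP r0 hr, inner_smul_right, real_inner_self_eq_norm_sq, norm_wHat hP]
  ring

theorem inner_sub_sub_rho (hr : r ∈ convexHull ℝ (Set.range P)) :
    inner ℝ (r - r0) (r - rho P r0) = ‖r - r0‖ ^ 2 - w0 P r0 ^ 2 := by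
  rw [rho, ← sub_sub, inner_sub_right, real_inner_self_eq_norm_sq, inner_smul_right,
    real_inner_comm, inner_wHat_sub_of_mem hP r0 hr, sq (w0 P r0)]

theorem divergence_solidAngleField (l : Fin 3) (hr : r ∈ convexHull ℝ (Set.range P))
    (h : r ≠ r0) :
    ∑ k, inner ℝ (![sHat P l, mHat P l] k)
        (fderiv ℝ (solidAngleField P r0) r (![sHat P l, mHat P l] k)) =
      |w0 P r0| / ‖r - r0‖ ^ 3 := by
  have hR := norm_pos_iff.2 (sub_ne_zero.2 h)
  have hunit : ∀ k, ‖![sHat P l, mHat P l] k‖ = 1 :=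
    Fin.forall_fin_two.2 ⟨norm_sHat hP l, norm_mHat hP l⟩
  have hdiv := sum_inner_fderiv_comp_norm_smul_sub hunit
    (tangent_frame_expansion hP l (sub_rho_mem_vectorSpan (r0 := r0) hP hr)) h
    (hasDerivAt_inv_mul_add (c := |w0 P r0|) hR.ne' (by positivity))
  refine hdiv.trans ?_
  rw [inner_sub_sub_rho hP hr, ← sq_abs (w0 P r0), Fintype.card_fin]
  field_simp
  ring

theorem inner_mHat_solidAngleField (r0 : E3) (l : Fin 3) (s : ℝ) :
    inner ℝ (mHat P l) (solidAngleField P r0 (sidePoint P r0 l s)) =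
      t0 P r0 l / (√(s ^ 2 + t0 P r0 l ^ 2 + |w0 P r0| ^ 2) *
        (√(s ^ 2 + t0 P r0 l ^ 2 + |w0 P r0| ^ 2) + |w0 P r0|)) := by
  rw [solidAngleField, inner_smul_right, inner_mHat_sidePoint_sub_rho hP,
    norm_sidePoint_sub hP, sq_abs, inv_mul_eq_div]

theorem setIntegral_facet_inner_mHat_solidAngleField (h0 : w0 P r0 ≠ 0) (l : Fin 3) :
    ∫ r in facet P l, inner ℝ (mHat P l) (solidAngleField P r0 r) ∂μHE[1] = betaSide P r0 l := by
  have hR : Rzero P r0 l ^ 2 = t0 P r0 l ^ 2 + w0 P r0 ^ 2 := Real.sq_sqrt (by positivity)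
  rw [setIntegral_facet_triangle hP r0]
  simp_rw [inner_mHat_solidAngleField hP]
  rw [integral_arctan_side (abs_pos.2 h0), betaSide, RPlus, RMinus, hR, sq_abs]

theorem setIntegral_abs_w0_div_norm_cube (h0 : w0 P r0 ≠ 0) :
    ∫ r in convexHull ℝ (Set.range P), |w0 P r0| / ‖r - r0‖ ^ 3 ∂μHE[2] = beta P r0 := by
  have hne {r : E3} (hr : r ∈ convexHull ℝ (Set.range P)) : r ≠ r0 := fun h => h0 <| by
    rw [← inner_wHat_sub_of_mem hP r0 hr, h, sub_self, inner_zero_right]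
  have hdiv := setIntegral_divergence_convexHull_range (tangent_frame_mem_vectorSpan hP 0)
    (fun v hv => tangent_frame_expansion hP 0 hv) (isOutwardNormal_mHat hP)
    (fun r hr => contDiffAt_solidAngleField P (hne hr))
  rw [setIntegral_congr_fun (isCompact_convexHull_range P).measurableSet
    fun r hr => divergence_solidAngleField hP 0 hr (hne hr)] at hdiv
  simp_rw [setIntegral_facet_inner_mHat_solidAngleField hP h0] at hdiv
  exact hdiv

theorem setIntegral_facet_invDist {l : Fin 3} (hf : RMinus P r0 l + sMinus P r0 l ≠ 0) :
    ∫ r in facet P l, invDist r0 r ∂μHE[1] = f2 P r0 l := by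
  rw [setIntegral_facet_triangle hP r0, f2, RPlus, RMinus]
  rw [RMinus] at hf
  simp_rw [invDist, norm_sidePoint_sub hP, one_div, add_assoc] at hf ⊢
  exact integral_inv_sqrt_sq_add (by positivity) (sMinus_le_sPlus hP r0 l) hf

section

variable (h : r0 ∉ convexHull ℝ (Set.range P))
include h

theorem inner_wHat_setIntegral_gradient_invDist :
    inner ℝ (wHat P) (∫ r in convexHull ℝ (Set.range P), ∇ (invDist r0) r ∂μHE[2]) =
      -(Real.sign (w0 P r0) * beta P r0) := by
  have hint : IntegrableOn (∇ (invDist r0)) (convexHull ℝ (Set.range P)) μHE[2] :=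
    integrableOn_gradient_convexHull_range fun r hr =>
      contDiffAt_invDist (ne_of_mem_of_not_mem hr h)
  have hinner : Set.EqOn (fun r => inner ℝ (wHat P) (∇ (invDist r0) r))
      (fun r => -(Real.sign (w0 P r0) * (|w0 P r0| / ‖r - r0‖ ^ 3)))
      (convexHull ℝ (Set.range P)) := fun r hr => by
    dsimp only
    rw [gradient_invDist (ne_of_mem_of_not_mem hr h), inner_smul_right,
      inner_wHat_sub_of_mem hP r0 hr, ← mul_div_assoc, sign_mul_abs]
    ring
  rw [← integral_inner hint,
    setIntegral_congr_fun (isCompact_convexHull_range P).measurableSet hinner, integral_neg,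
    integral_const_mul]
  obtain h0 | h0 := eq_or_ne (w0 P r0) 0
  · rw [h0, Real.sign_zero, zero_mul, zero_mul]
  · rw [setIntegral_abs_w0_div_norm_cube hP h0]

theorem setIntegral_gradient_invDist (hf : ∀ l, RMinus P r0 l + sMinus P r0 l ≠ 0) :
    ∫ r in convexHull ℝ (Set.range P), ∇ (invDist r0) r ∂μHE[2] = faceVector P r0 := by
  have hplane {v : E3} (hv : v ∈ vectorSpan ℝ (Set.range P)) :
      inner ℝ v (∫ r in convexHull ℝ (Set.range P), ∇ (invDist r0) r ∂μHE[2]) =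
        inner ℝ v (faceVector P r0) := by
    rw [inner_setIntegral_gradient_convexHull_range (isOutwardNormal_mHat hP)
      (fun r hr => contDiffAt_invDist (ne_of_mem_of_not_mem hr h)) hv, faceVector, inner_add_right,
      inner_neg_right, inner_smul_right, real_inner_comm,
      (mem_vectorSpan_iff_inner_wHat_eq_zero hP).1 hv, mul_zero, neg_zero, zero_add, inner_sum]
    exact Finset.sum_congr rfl fun l _ => by
      rw [setIntegral_facet_invDist hP (hf l), inner_smul_right]
  have hnormal : inner ℝ (wHat P) (∫ r in convexHull ℝ (Set.range P), ∇ (invDist r0) r ∂μHE[2]) =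
      inner ℝ (wHat P) (faceVector P r0) := by
    rw [inner_wHat_setIntegral_gradient_invDist hP h, faceVector, inner_add_right,
      inner_neg_right, inner_smul_right, real_inner_self_eq_norm_sq, norm_wHat hP, inner_sum]
    simp_rw [inner_smul_right, inner_wHat_mHat, mul_zero, Finset.sum_const_zero]
    ring
  have hmem : (∫ r in convexHull ℝ (Set.range P), ∇ (invDist r0) r ∂μHE[2]) - faceVector P r0 ∈
      vectorSpan ℝ (Set.range P) :=
    (mem_vectorSpan_iff_inner_wHat_eq_zero hP).2 (by rw [inner_sub_right, hnormal, sub_self])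
  rw [← sub_eq_zero, ← inner_self_eq_zero (𝕜 := ℝ), inner_sub_right, hplane hmem, sub_self]

end

end

section

variable (p : AffineBasis (Fin 4) ℝ E3) {q r0 : E3}

theorem setIntegral_gradient_tetra {g : E3 → ℝ} (hg : ∀ r ∈ tetra p, ContDiffAt ℝ 1 g r) :
    ∫ r in tetra p, ∇ g r = ∑ i, (∫ r in face p i, g r ∂μHE[2]) • outwardNormal p i := by
  rw [← EuclideanSpace.euclideanHausdorffMeasure_eq_volume 3]
  exact setIntegral_gradient_convexHull_range (isOutwardNormal_outwardNormal p)
    (vectorSpan_range_eq_top p) hg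

theorem gradient_coord (i : Fin 4) (r : E3) :
    ∇ (fun x => p.coord i x) r = (1 / (6 * vol p)) • WithLp.toLp 2 ((Lam p)ᵀ i) := by
  refine HasGradientAt.gradient ?_
  rw [hasGradientAt_iff_hasFDerivAt]
  have haffine : (fun x => p.coord i x) = fun x =>
      InnerProductSpace.toDual ℝ E3 ((1 / (6 * vol p)) • WithLp.toLp 2 ((Lam p)ᵀ i)) x +
        1 / (6 * vol p) * coefA p i := by
    ext x
    rw [coord_eq, InnerProductSpace.toDual_apply_apply, real_inner_smul_left, inner_eq]
    simp only [Matrix.mulVec, dotProduct, Fin.sum_univ_three]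
    ring
  rw [haffine]
  exact (ContinuousLinearMap.hasFDerivAt _).add_const _

theorem inner_toLp_row {m n : Type*} [Fintype n] (A : Matrix m n ℝ) (i : m)
    (v : EuclideanSpace ℝ n) : inner ℝ (WithLp.toLp 2 (A i)) v = (A *ᵥ v.ofLp) i := by
  rw [EuclideanSpace.inner_eq_star_dotProduct, star_trivial, dotProduct_comm]
  rfl

theorem bvIntegrand_eq (σc : Matrix (Fin 3) (Fin 3) ℝ) (q r0 : E3) (i : Fin 4) (r : E3) :
    bvIntegrand p σc q r0 i r =
      1 / (6 * vol p) * inner ℝ (WithLp.toLp 2 (((Lam p)ᵀ * σc) i)) (∇ (dipole q r0) r) := by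
  rw [bvIntegrand, gradient_coord, real_inner_smul_right, real_inner_comm, inner_toLp_row,
    inner_toLp_row, Matrix.mulVec_mulVec]

theorem integrableOn_gradient_dipole_tetra (q : E3) (h : r0 ∉ tetra p) :
    IntegrableOn (∇ (dipole q r0)) (tetra p) := by
  rw [← EuclideanSpace.euclideanHausdorffMeasure_eq_volume 3]
  exact integrableOn_gradient_convexHull_range fun r hr =>
    contDiffAt_dipole q (ne_of_mem_of_not_mem hr h)

theorem integrableOn_bvIntegrand (σc : Matrix (Fin 3) (Fin 3) ℝ) (q : E3) (h : r0 ∉ tetra p)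
    (i : Fin 4) : IntegrableOn (bvIntegrand p σc q r0 i) (tetra p) := by
  rw [funext (bvIntegrand_eq p σc q r0 i)]
  exact ((integrableOn_gradient_dipole_tetra p q h).const_inner _).const_mul _

theorem bv_eq (σc : Matrix (Fin 3) (Fin 3) ℝ) (σinf : ℝ) (q : E3) (h : r0 ∉ tetra p) :
    bv p σc σinf q r0 =
      (1 / (24 * vol p * π * σinf)) • (((Lam p)ᵀ * σc) *ᵥ
        (∑ i, (∫ r in face p i, dipole q r0 r ∂μHE[2]) • outwardNormal p i).ofLp) := by
  ext i
  rw [bv, funext (bvIntegrand_eq p σc q r0 i), integral_const_mul,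
    integral_inner (integrableOn_gradient_dipole_tetra p q h), setIntegral_gradient_tetra p
      fun r hr => contDiffAt_dipole q (ne_of_mem_of_not_mem hr h), inner_toLp_row, ← mul_assoc,
    one_div_mul_one_div, Pi.smul_apply, smul_eq_mul]
  ring_nf

theorem integrableOn_dipole_face {i : Fin 4} (q : E3) (h : r0 ∉ face p i) :
    IntegrableOn (dipole q r0) (face p i) μHE[2] :=
  integrableOn_facet fun _ hr =>
    (contDiffAt_dipole q (ne_of_mem_of_not_mem hr h)).continuousAt.continuousWithinAt

theorem integrableOn_gradient_invDist_face {i : Fin 4} (h : r0 ∉ face p i) :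
    IntegrableOn (∇ (invDist r0)) (face p i) μHE[2] :=
  integrableOn_facet fun _ hr =>
    (continuousAt_gradient (contDiffAt_invDist (ne_of_mem_of_not_mem hr h))).continuousWithinAt

theorem measurableSet_face (i : Fin 4) : MeasurableSet (face p i) := by
  rw [show face p i = _ from facet_eq_convexHull_range p i]
  exact (isCompact_convexHull_range _).measurableSet

theorem setIntegral_dipole_face {i : Fin 4} (q : E3) (h : r0 ∉ face p i) :
    ∫ r in face p i, dipole q r0 r ∂μHE[2] =
      -inner ℝ q (∫ r in face p i, ∇ (invDist r0) r ∂μHE[2]) := by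
  rw [← integral_inner (integrableOn_gradient_invDist_face p h), ← integral_neg]
  exact setIntegral_congr_fun (measurableSet_face p i) fun r hr =>
    dipole_eq_neg_inner_gradient q (ne_of_mem_of_not_mem hr h)

theorem face_eq_convexHull_range {i : Fin 4} (e : Fin 3 ≃ {j : Fin 4 // j ≠ i}) :
    face p i = convexHull ℝ (Set.range fun k => p (e k)) := by
  rw [face, ← Subtype.range_coe_subtype (p := fun j => j ≠ i), ← Set.range_comp,
    ← e.surjective.range_comp]
  rfl

theorem affineIndependent_face {i : Fin 4} (e : Fin 3 ≃ {j : Fin 4 // j ≠ i}) :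
    AffineIndependent ℝ fun k => p (e k) :=
  p.ind.comp_embedding (e.toEmbedding.trans (Function.Embedding.subtype _))

theorem setIntegral_gradient_invDist_face {i : Fin 4} (h : r0 ∉ face p i)
    (e : Fin 3 ≃ {j : Fin 4 // j ≠ i})
    (he : ∀ l, RMinus (fun k => p (e k)) r0 l + sMinus (fun k => p (e k)) r0 l ≠ 0) :
    ∫ r in face p i, ∇ (invDist r0) r ∂μHE[2] = faceVector (fun k => p (e k)) r0 := by
  rw [face_eq_convexHull_range p e] at h ⊢
  exact setIntegral_gradient_invDist (affineIndependent_face p e) h he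

end

end EEG

end

theorem mainTheorem4 (p : AffineBasis (Fin 4) ℝ EEG.E3) (σc : Matrix (Fin 3) (Fin 3) ℝ)
    (σinf : ℝ) (hσ : 0 < σinf) (q r0 : EEG.E3) :
    -- the volume element vector, for a source outside the closed tetrahedron
    (r0 ∉ EEG.tetra p →
      (∀ i, IntegrableOn (EEG.bvIntegrand p σc q r0 i) (EEG.tetra p)) ∧
      EEG.bv p σc σinf q r0 =
        (1 / (24 * EEG.vol p * π * σinf)) • (((EEG.Lam p)ᵀ * σc) *ᵥ
          (∑ i, (∫ r in EEG.face p i, EEG.dipole q r0 r ∂(Measure.euclideanHausdorffMeasure 2)) •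
            EEG.outwardNormal p i).ofLp)) ∧
    -- the face integrals, for a source off the face
    (∀ i : Fin 4, r0 ∉ EEG.face p i →
      IntegrableOn (EEG.dipole q r0) (EEG.face p i) (Measure.euclideanHausdorffMeasure 2) ∧
      IntegrableOn (fun r => ∇ (EEG.invDist r0) r) (EEG.face p i)
        (Measure.euclideanHausdorffMeasure 2) ∧
      ∫ r in EEG.face p i, EEG.dipole q r0 r ∂(Measure.euclideanHausdorffMeasure 2) =
        -inner ℝ q (∫ r in EEG.face p i, ∇ (EEG.invDist r0) r
          ∂(Measure.euclideanHausdorffMeasure 2)) ∧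
      -- for every numbering of the nodes of the face for which the logarithms are defined
      ∀ e : Fin 3 ≃ {j : Fin 4 // j ≠ i},
        (∀ l, EEG.RMinus (fun k => p (e k)) r0 l + EEG.sMinus (fun k => p (e k)) r0 l ≠ 0) →
        ∫ r in EEG.face p i, EEG.dipole q r0 r ∂(Measure.euclideanHausdorffMeasure 2) =
          -inner ℝ q (EEG.faceVector (fun k => p (e k)) r0)) := by
  refine ⟨fun h => ⟨EEG.integrableOn_bvIntegrand p σc q h, EEG.bv_eq p σc σinf q h⟩, fun i h =>
    ⟨EEG.integrableOn_dipole_face p q h, EEG.integrableOn_gradient_invDist_face p h,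
      EEG.setIntegral_dipole_face p q h, fun e he => ?_⟩⟩
  rw [EEG.setIntegral_dipole_face p q h, EEG.setIntegral_gradient_invDist_face p h e he]
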